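/- Let $n\ge 1$ and, for a weight $w$ (a nonnegative locally integrable function on $\mathbb R^n$), write $w(A)=\int_A w$, $\psi_{w,\lambda}(B)=w(B)^{\lambda/n}$ and $w_\beta(x)=|x|^\beta$. For $1\le p<\infty$ and a positive function $\varphi$ of balls, $\mathcal{LM}^p(\varphi,w)$ and $W\mathcal{LM}^p(\varphi,w)$ are the spaces of measurable functions $f$ on $\mathbb R^n$ for which, respectively, $$\|f\|_{\mathcal{LM}^p(\varphi,w)}=\sup_B\Big(\frac1{\varphi(B)}\int_B|f|^pw\Big)^{1/p}<\infty,\qquad \|f\|_{W\mathcal{LM}^p(\varphi,w)}=\sup_B\sup_{t>0}\frac{t\,w(\{x\in B:|f(x)|>t\})^{1/p}}{\varphi(B)^{1/p}}<\infty,$$ the suprema being over all balls $B$ centered at the origin. Let $$I_\alpha f(x)=\int_{\mathbb R^n}\frac{f(y)}{|x-y|^{n-\alpha}}\,dy,\qquad M_\alpha f(x)=\sup_{B\ni x}\frac1{|B|^{1-\alpha/n}}\int_B|f|,$$ the last supremum being over all balls $B$ of $\mathbb R^n$ containing $x$. That $I_\alpha$ is bounded from $X$ to $Y$ means that for every $f\in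 X$ the integral $I_\alpha f(x)$ converges absolutely for almost every $x$, $I_\alpha f\in Y$, and $\|I_\alpha f\|_Y\le C\|f\|_X$ with $C$ independent of $f$; that $M_\alpha$ is bounded from $X$ to $Y$ means that $M_\alpha f\in Y$ and $\|M_\alpha f\|_Y\le C\|f\|_X$ for every $f\in X$, with $C$ independent of $f$. Let $0<\alpha<n$, $0\le\gamma\le\alpha$, $1\le p<n/\gamma$ (that is, $1\le p<\infty$ if $\gamma=0$), $\frac1p-\frac1q=\frac\gamma n$, $\lambda_1,\lambda_2>0$, and let $\beta_1,\beta_2\in\mathbb R$ satisfy $\beta_1p+n>0$ and $\beta_2q+n>0$ (so that $w_{\beta_1}^p$ and $w_{\beta_2}^q$ are locally integrable). Consider the conditions $$(n-\lambda_2)\Big(\frac1q+\frac{\beta_2}n\Big)-(n-\lambda_1)\Big(\frac1p+\frac{\beta_1}n\Big)+\alpha=0,\tag{1}$$ $$\alpha<(n-\lambda_1)\Big(\frac1p+\frac{\beta_1}n\Big)<n.\tag{2}$$ (a) If $p>1$, then $I_\alpha$ is bounded from $\mathcal{LM}^p(\psi_{w_{\beta_1}^p,\lambda_1},w_{\beta_1}^p)$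 to $\mathcal{LM}^q(\psi_{w_{\beta_2}^q,\lambda_2},w_{\beta_2}^q)$ if and only if (1) and (2) hold. (b) If $p=1$ (so $q=n/(n-\gamma)$), then $I_\alpha$ is bounded from $\mathcal{LM}^1(\psi_{w_{\beta_1},\lambda_1},w_{\beta_1})$ to $W\mathcal{LM}^q(\psi_{w_{\beta_2}^q,\lambda_2},w_{\beta_2}^q)$ if and only if (1) and (2) hold. (c) Both (a) and (b) hold for $M_\alpha$ in place of $I_\alpha$ if in (2) the left-hand inequality is replaced by $\alpha\le(n-\lambda_1)\big(\frac1p+\frac{\beta_1}n\big)$. -/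

import Mathlib

open MeasureTheory
open scoped ENNReal NNReal

noncomputable section

namespace LocalMorrey

/-- Euclidean space `ℝⁿ`. -/
abbrev Euc (n : ℕ) : Type := EuclideanSpace ℝ (Fin n)

/-- `w(A) = ∫_A w`, the mass of the set `A` for the weight `w`. -/
def mass {n : ℕ} (w : Euc n → ℝ) (A : Set (Euc n)) : ℝ≥0∞ :=
  ∫⁻ x in A, ENNReal.ofReal (w x)

/-- The power weight `w_β(x) = |x|^β`. -/
def powerWeight {n : ℕ} (β : ℝ) (x : Euc n) : ℝ := ‖x‖ ^ β

/-- The power `w^p` of a weight. -/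
def weightPow {n : ℕ} (w : Euc n → ℝ) (p : ℝ) (x : Euc n) : ℝ := (w x) ^ p

/-- The Komori-Shirai function on balls, `ψ_{w,l}(B) = w(B)^(l/n)`. -/
def psi {n : ℕ} (w : Euc n → ℝ) (l : ℝ) (B : Set (Euc n)) : ℝ≥0∞ :=
  (mass w B) ^ (l / n)

/-- The extended norm of the weighted local Morrey space `LM^p(φ, w)`: the supremum over the balls
`B` centred at the origin of `(φ(B)⁻¹ ∫_B |f|^p w)^(1/p)`. -/
def normLM {n : ℕ} {ε : Type*} [ENorm ε] (p : ℝ) (φ : Set (Euc n) → ℝ≥0∞) (w : Euc n → ℝ)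
    (f : Euc n → ε) : ℝ≥0∞ :=
  ⨆ (r : ℝ) (_ : 0 < r),
    ((∫⁻ x in Metric.ball (0 : Euc n) r, ‖f x‖ₑ ^ p * ENNReal.ofReal (w x)) /
      φ (Metric.ball 0 r)) ^ (1 / p)

/-- The extended quasi-norm of the weak local Morrey space `WLM^p(φ, w)`: the supremum over the
balls `B` centred at the origin and `t > 0` of `t w({x ∈ B : |f(x)| > t})^(1/p) / φ(B)^(1/p)`. -/
def normWLM {n : ℕ} {ε : Type*} [ENorm ε] (p : ℝ) (φ : Set (Euc n) → ℝ≥0∞) (w : Euc n → ℝ)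
    (f : Euc n → ε) : ℝ≥0∞ :=
  ⨆ (r : ℝ) (_ : 0 < r) (t : ℝ≥0) (_ : 0 < t),
    (t : ℝ≥0∞) * (mass w {x ∈ Metric.ball (0 : Euc n) r | (t : ℝ≥0∞) < ‖f x‖ₑ}) ^ (1 / p) /
      (φ (Metric.ball 0 r)) ^ (1 / p)

/-- `f` belongs to the space of measurable functions on which the extended norm `N` is finite. -/
def Mem {n : ℕ} {ε : Type*} [TopologicalSpace ε] (N : (Euc n → ε) → ℝ≥0∞) (f : Euc n → ε) : Prop :=
  AEStronglyMeasurable f volume ∧ N f < ∞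

section Operators

variable {n : ℕ} {𝕜 : Type*} [RCLike 𝕜]

/-- The integrand `y ↦ f(y) / |x - y|^(n - α)` of the fractional integral at `x`. -/
def fracIntegrand (α : ℝ) (f : Euc n → 𝕜) (x y : Euc n) : 𝕜 :=
  (‖x - y‖ ^ ((n : ℝ) - α))⁻¹ • f y

/-- The fractional integral `I_α f(x) = ∫ f(y) / |x - y|^(n - α) dy`. -/
def fracIntegral (α : ℝ) (f : Euc n → 𝕜) (x : Euc n) : 𝕜 :=
  ∫ y, fracIntegrand α f x y

/-- The fractional maximal function: `M_α f(x)` is the supremum of `|B|^(α/n - 1) ∫_B |f|` over all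
balls `B` containing `x`. -/
def fracMaximal (α : ℝ) (f : Euc n → 𝕜) (x : Euc n) : ℝ≥0∞ :=
  ⨆ (c : Euc n) (r : ℝ) (_ : x ∈ Metric.ball c r),
    (∫⁻ y in Metric.ball c r, ‖f y‖ₑ) / (volume (Metric.ball c r)) ^ (1 - α / n)

/-- `I_α` is bounded from the space with norm `X` to the space with (quasi-)norm `Y`: for every `f`
in the first space the integral defining `I_α f(x)` converges absolutely for almost every `x`,
`I_α f` lies in the second space, and `‖I_α f‖_Y ≤ C ‖f‖_X` with `C` independent of `f`. -/
def FracIntegralBounded (α : ℝ) (X Y : (Euc n → 𝕜) → ℝ≥0∞) : Prop :=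
  ∃ C : ℝ≥0, ∀ f : Euc n → 𝕜, Mem X f →
    (∀ᵐ x, Integrable (fracIntegrand α f x) volume) ∧
      Mem Y (fracIntegral α f) ∧ Y (fracIntegral α f) ≤ C * X f

/-- `M_α` is bounded from the space with norm `X` to the space with (quasi-)norm `Y`. -/
def FracMaximalBounded (α : ℝ) (X : (Euc n → 𝕜) → ℝ≥0∞) (Y : (Euc n → ℝ≥0∞) → ℝ≥0∞) : Prop :=
  ∃ C : ℝ≥0, ∀ f : Euc n → 𝕜, Mem X f →
    Mem Y (fracMaximal α f) ∧ Y (fracMaximal α f) ≤ C * X f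

end Operators

/-- The norm of the Komori-Shirai space `LM^p(ψ_{w_β^p, l}, w_β^p)` with power weight. -/
def normKS {n : ℕ} {ε : Type*} [ENorm ε] (p l β : ℝ) (f : Euc n → ε) : ℝ≥0∞ :=
  normLM p (psi (weightPow (powerWeight β) p) l) (weightPow (powerWeight β) p) f

/-- The quasi-norm of the weak Komori-Shirai space `WLM^p(ψ_{w_β^p, l}, w_β^p)`. -/
def normWKS {n : ℕ} {ε : Type*} [ENorm ε] (p l β : ℝ) (f : Euc n → ε) : ℝ≥0∞ :=
  normWLM p (psi (weightPow (powerWeight β) p) l) (weightPow (powerWeight β) p) f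

end LocalMorrey

end

/-! ### Dyadic annuli and geometric sums -/

namespace LocalMorrey

open Metric Set

/-! Put A = (n-λ₁)(1/p+β₁/n) and A' = (n-λ₂)(1/q+β₂/n). On the dyadic annulus of radius R the weight
is comparable to R^(βp), and the mass of a centred ball of radius R is comparable to R^(βp+n). Hence
f has finite source norm exactly when its L^p norm on each such annulus is O(R^(n/p-A)): the passage
from annuli to balls is a geometric sum whose exponent (βp+n)λ/n is positive. The weights, λ and β
thus enter only through A and A'. The theorem says that boundedness holds exactly when A' = A-α and
α < A < n (α ≤ A < n for the maximal operator).

Sufficiency. Fix |x| ~ R and split f into the parts near the origin, far away, and in a ring around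
|y| ~ R. By Hölder, the integral of |f| over an annulus of radius r is O(r^(n-A)). The inner part
contributes R^(α-n) times a sum of r^(n-A) over r ≲ R, convergent as A < n. The outer part
contributes a sum of r^(α-A) over r ≳ R, convergent as α < A. Both are O(R^(α-A)), which is the size
the target space allows when A' = A-α. For the ring only distances |x-y| < 3R occur, and the
truncated potential maps L^p to L^q (weakly if p = 1) with norm O(R^(α-γ)) by Hedberg's inequality
and the Hardy-Littlewood maximal theorem (`exists_truncated_fracIntegral_le_maximal`). For the
maximal operator large balls give a supremum of r^(α-A) instead of a sum, so α = A is harmless.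

Necessity. The function |x|^(-A) always belongs to the source space. Its fractional maximal function
is at least c R^(α-A) on the ball of radius R. Testing the weak target norm on every annulus forces
A' = A-α, finiteness at one point forces α ≤ A (let R grow) and A < n (integrability at the origin).
For the potential, α = A is excluded because its integral then diverges logarithmically at infinity.
Since the weak norm is dominated by the strong one, only weak bounds are used
(`exponents_of_normWKS_ne_top`). -/

theorem rpow_le_rpow_of_nonpos {x y : ℝ≥0∞} {z : ℝ} (hz : z ≤ 0) (h : x ≤ y) :
    y ^ z ≤ x ^ z := by
  rw [← neg_neg z, ENNReal.rpow_neg y, ENNReal.rpow_neg x, ENNReal.inv_le_inv]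
  exact ENNReal.rpow_le_rpow h (by linarith)

theorem ofReal_rpow_mul {r : ℝ} (hr : 0 < r) (a b : ℝ) :
    ENNReal.ofReal r ^ a * ENNReal.ofReal r ^ b = ENNReal.ofReal r ^ (a + b) :=
  (ENNReal.rpow_add _ _ (by simpa using hr) ENNReal.ofReal_ne_top).symm

theorem ofReal_rpow_ne_top {r : ℝ} (hr : 0 < r) (a : ℝ) : ENNReal.ofReal r ^ a ≠ ⊤ :=
  ENNReal.rpow_ne_top_of_ne_zero (by simpa using hr) ENNReal.ofReal_ne_top

theorem ofReal_rpow_ne_zero {r : ℝ} (hr : 0 < r) (a : ℝ) : ENNReal.ofReal r ^ a ≠ 0 := by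
  simp [ENNReal.rpow_eq_zero_iff, hr]

theorem ofReal_mul_rpow {r s : ℝ} (hr : 0 < r) (a : ℝ) :
    ENNReal.ofReal (r * s) ^ a = ENNReal.ofReal r ^ a * ENNReal.ofReal s ^ a := by
  rw [ENNReal.ofReal_mul hr.le, ENNReal.mul_rpow_of_ne_top] <;> simp

variable {n : ℕ}

/-- The dyadic annulus of outer radius `r` around `x`. -/
def ann (x : Euc n) (r : ℝ) : Set (Euc n) := ball x r \ ball x (r / 2)

theorem mem_ann {x y : Euc n} {r : ℝ} : y ∈ ann x r ↔ r / 2 ≤ dist y x ∧ dist y x < r := by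
  simp [ann, and_comm]

theorem measurableSet_ann (x : Euc n) (r : ℝ) : MeasurableSet (ann x r) :=
  measurableSet_ball.diff measurableSet_ball

/-- A nonvanishing power is comparable to a constant on a dyadic annulus. -/
theorem rpow_dyadic_le {s r : ℝ} (h₁ : r / 2 ≤ s) (h₂ : s ≤ r) (a : ℝ) :
    ENNReal.ofReal s ^ a ≤ 2 ^ |a| * ENNReal.ofReal r ^ a := by
  have h2 : (2 : ℝ≥0∞) = ENNReal.ofReal 2 := by simp
  rcases le_total 0 a with ha | ha
  · calc ENNReal.ofReal s ^ a ≤ 1 * ENNReal.ofReal r ^ a := by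
          rw [one_mul]; gcongr
      _ ≤ _ := by
          gcongr
          simpa using ENNReal.rpow_le_rpow (z := |a|) one_le_two (abs_nonneg a)
  · have h : ENNReal.ofReal s ^ a ≤ ENNReal.ofReal (r / 2) ^ a :=
      rpow_le_rpow_of_nonpos ha (ENNReal.ofReal_le_ofReal h₁)
    refine h.trans (le_of_eq ?_)
    rw [abs_of_nonpos ha, div_eq_inv_mul, ofReal_mul_rpow (by norm_num),
      ENNReal.ofReal_inv_of_pos (by norm_num), ENNReal.inv_rpow, ← ENNReal.rpow_neg]
    simp

theorem le_rpow_dyadic {s r : ℝ} (hr : 0 < r) (h₁ : r / 2 ≤ s) (h₂ : s ≤ r) (a : ℝ) :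
    ENNReal.ofReal r ^ a ≤ 2 ^ |a| * ENNReal.ofReal s ^ a := by
  have hs : 0 < s := by linarith
  have h := rpow_dyadic_le h₁ h₂ (-a)
  calc ENNReal.ofReal r ^ a
      = ENNReal.ofReal r ^ a * ENNReal.ofReal s ^ a * ENNReal.ofReal s ^ (-a) := by
        rw [mul_assoc, ofReal_rpow_mul hs]; simp
    _ ≤ ENNReal.ofReal r ^ a * ENNReal.ofReal s ^ a *
          (2 ^ |-a| * ENNReal.ofReal r ^ (-a)) := by gcongr
    _ = 2 ^ |a| * ENNReal.ofReal s ^ a * (ENNReal.ofReal r ^ a * ENNReal.ofReal r ^ (-a)) := by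
        rw [abs_neg]; ring
    _ = _ := by rw [ofReal_rpow_mul hr]; simp

theorem enorm_sub_eq_ofReal_dist (x y : Euc n) : ‖x - y‖ₑ = ENNReal.ofReal (dist y x) := by
  rw [dist_comm, dist_eq_norm, ofReal_norm]

theorem setLIntegral_rpow_mul_ann_le (x : Euc n) {r : ℝ} (hr : 0 < r) (a : ℝ)
    (F : Euc n → ℝ≥0∞) :
    ∫⁻ y in ann x r, ‖x - y‖ₑ ^ a * F y ≤
      2 ^ |a| * ENNReal.ofReal r ^ a * ∫⁻ y in ann x r, F y := by
  rw [← lintegral_const_mul' _ _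
    (ENNReal.mul_ne_top (by simp) (ofReal_rpow_ne_top hr a))]
  refine setLIntegral_mono' (measurableSet_ann x r) fun y hy => ?_
  rw [mem_ann] at hy
  rw [enorm_sub_eq_ofReal_dist]
  gcongr
  exact rpow_dyadic_le hy.1 hy.2.le a

theorem ball_subset_iUnion_ann (x : Euc n) {R : ℝ} (hR : 0 < R) :
    ball x R ⊆ {x} ∪ ⋃ k : ℕ, ann x (R * (1 / 2) ^ k) := by
  intro y hy
  by_cases hxy : y = x
  · exact Or.inl hxy
  right
  have hd : 0 < dist y x := dist_pos.2 hxy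
  obtain ⟨k, hk₁, hk₂⟩ := exists_nat_pow_near_of_lt_one (x := dist y x / R) (y := 1 / 2)
    (by positivity) ((div_le_one hR).2 (mem_ball.1 hy).le) (by norm_num) (by norm_num)
  rw [lt_div_iff₀ hR, pow_succ] at hk₁
  rw [div_le_iff₀ hR] at hk₂
  -- The annuli are closed inside and open outside. A point on the outer sphere of the k-th annulus
  -- therefore lies in the preceding, larger one; for k = 0 it would lie outside the open ball.
  rcases hk₂.lt_or_eq with hk₂ | hk₂
  · exact mem_iUnion.2 ⟨k, mem_ann.2 ⟨by linarith, by linarith⟩⟩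
  · rcases k with _ | k
    · simp at hk₂; simp [mem_ball, hk₂] at hy
    · refine mem_iUnion.2 ⟨k, mem_ann.2 ⟨by rw [pow_succ] at hk₂; linarith, ?_⟩⟩
      rw [hk₂, mul_comm R, pow_succ]
      have : (0 : ℝ) < (1 / 2) ^ k * R := by positivity
      linarith

theorem compl_ball_subset_iUnion_ann (x : Euc n) {R : ℝ} (hR : 0 < R) :
    (ball x R)ᶜ ⊆ ⋃ k : ℕ, ann x (2 * R * 2 ^ k) := by
  intro y hy
  have hy' : R ≤ dist y x := by simpa using hy
  obtain ⟨k, hk₁, hk₂⟩ := exists_nat_pow_near (x := dist y x / R) (y := 2)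
    ((one_le_div hR).2 hy') (by norm_num)
  rw [le_div_iff₀ hR] at hk₁
  rw [div_lt_iff₀ hR, pow_succ] at hk₂
  exact mem_iUnion.2 ⟨k, mem_ann.2 ⟨by linarith, by linarith⟩⟩

/-- The sum over shrinking annuli is stated without a sign condition, since for b ≤ 0 its constant
is just `⊤`. Convergence, that is b > 0, enters only here. -/
theorem geometric_ne_top {b : ℝ} (hb : 0 < b) : (1 - (2 : ℝ≥0∞) ^ (-b))⁻¹ ≠ ⊤ := by
  simp [tsub_eq_zero_iff_le, ENNReal.rpow_lt_one_of_one_lt_of_neg, hb]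

theorem ofReal_mul_pow_rpow {R c : ℝ} (hR : 0 < R) (hc : 0 < c) (k : ℕ) (b : ℝ) :
    ENNReal.ofReal (R * c ^ k) ^ b = ENNReal.ofReal R ^ b * (ENNReal.ofReal c ^ b) ^ k := by
  rw [ofReal_mul_rpow hR, ENNReal.ofReal_pow hc.le, ← ENNReal.rpow_natCast,
    ← ENNReal.rpow_natCast, ← ENNReal.rpow_mul, ← ENNReal.rpow_mul, mul_comm b]

/-- Summation of dyadic annuli shrinking to the centre. -/
theorem setLIntegral_ball_le_of_ann [NeZero n] (x : Euc n) {b : ℝ} {K : ℝ≥0∞}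
    {F : Euc n → ℝ≥0∞}
    (h : ∀ r, 0 < r → ∫⁻ y in ann x r, F y ≤ K * ENNReal.ofReal r ^ b) {R : ℝ} (hR : 0 < R) :
    ∫⁻ y in ball x R, F y ≤ (1 - (2 : ℝ≥0∞) ^ (-b))⁻¹ * (K * ENNReal.ofReal R ^ b) := by
  calc ∫⁻ y in ball x R, F y
      ≤ ∫⁻ y in {x} ∪ ⋃ k : ℕ, ann x (R * (1 / 2) ^ k), F y :=
        lintegral_mono_set (ball_subset_iUnion_ann x hR)
    _ ≤ (∫⁻ y in {x}, F y) + ∫⁻ y in ⋃ k : ℕ, ann x (R * (1 / 2) ^ k), F y :=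
        lintegral_union_le F _ _
    _ ≤ 0 + ∑' k : ℕ, ∫⁻ y in ann x (R * (1 / 2) ^ k), F y :=
        add_le_add (setLIntegral_measure_zero _ _ (measure_singleton x)).le
          (lintegral_iUnion_le _ _)
    _ ≤ ∑' k : ℕ, K * ENNReal.ofReal R ^ b * ((2 : ℝ≥0∞) ^ (-b)) ^ k := by
        rw [zero_add]
        refine ENNReal.tsum_le_tsum fun k => (h _ (by positivity)).trans (le_of_eq ?_)
        rw [ofReal_mul_pow_rpow hR (by norm_num), mul_assoc, one_div,
          ENNReal.ofReal_inv_of_pos (by norm_num), ENNReal.inv_rpow, ← ENNReal.rpow_neg]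
        simp
    _ = _ := by rw [ENNReal.tsum_mul_left, ENNReal.tsum_geometric, mul_comm]

/-- Summation of dyadic annuli growing to infinity. -/
theorem setLIntegral_compl_ball_le_of_ann (x : Euc n) {b : ℝ} (hb : b < 0) {K : ℝ≥0∞}
    {F : Euc n → ℝ≥0∞}
    (h : ∀ r, 0 < r → ∫⁻ y in ann x r, F y ≤ K * ENNReal.ofReal r ^ b) {R : ℝ} (hR : 0 < R) :
    ∫⁻ y in (ball x R)ᶜ, F y ≤ (1 - (2 : ℝ≥0∞) ^ b)⁻¹ * (K * ENNReal.ofReal R ^ b) := by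
  calc ∫⁻ y in (ball x R)ᶜ, F y
      ≤ ∫⁻ y in ⋃ k : ℕ, ann x (2 * R * 2 ^ k), F y :=
        lintegral_mono_set (compl_ball_subset_iUnion_ann x hR)
    _ ≤ ∑' k : ℕ, ∫⁻ y in ann x (2 * R * 2 ^ k), F y := lintegral_iUnion_le _ _
    _ ≤ ∑' k : ℕ, K * ENNReal.ofReal R ^ b * ((2 : ℝ≥0∞) ^ b) ^ k := by
        refine ENNReal.tsum_le_tsum fun k => (h _ (by positivity)).trans ?_
        rw [ofReal_mul_pow_rpow (by positivity) (by norm_num), mul_assoc]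
        have : ENNReal.ofReal (2 * R) ^ b ≤ ENNReal.ofReal R ^ b :=
          rpow_le_rpow_of_nonpos hb.le (ENNReal.ofReal_le_ofReal (by linarith))
        simp only [ENNReal.ofReal_ofNat]
        gcongr
    _ = _ := by rw [ENNReal.tsum_mul_left, ENNReal.tsum_geometric, mul_comm]

theorem setLIntegral_rpow_mul_ball_le [NeZero n] (x : Euc n) {a b : ℝ}
    {K : ℝ≥0∞} {F : Euc n → ℝ≥0∞}
    (h : ∀ r, 0 < r → ∫⁻ y in ann x r, F y ≤ K * ENNReal.ofReal r ^ b) {R : ℝ} (hR : 0 < R) :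
    ∫⁻ y in ball x R, ‖x - y‖ₑ ^ a * F y ≤
      (1 - (2 : ℝ≥0∞) ^ (-(a + b)))⁻¹ * (2 ^ |a| * K * ENNReal.ofReal R ^ (a + b)) := by
  refine setLIntegral_ball_le_of_ann x (fun r hr => ?_) hR
  refine (setLIntegral_rpow_mul_ann_le x hr a F).trans ?_
  grw [h r hr, ← ofReal_rpow_mul hr]
  exact le_of_eq (by ring)

theorem setLIntegral_rpow_mul_compl_ball_le (x : Euc n) {a b : ℝ} (hab : a + b < 0)
    {K : ℝ≥0∞} {F : Euc n → ℝ≥0∞}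
    (h : ∀ r, 0 < r → ∫⁻ y in ann x r, F y ≤ K * ENNReal.ofReal r ^ b) {R : ℝ} (hR : 0 < R) :
    ∫⁻ y in (ball x R)ᶜ, ‖x - y‖ₑ ^ a * F y ≤
      (1 - (2 : ℝ≥0∞) ^ (a + b))⁻¹ * (2 ^ |a| * K * ENNReal.ofReal R ^ (a + b)) := by
  refine setLIntegral_compl_ball_le_of_ann x hab (fun r hr => ?_) hR
  refine (setLIntegral_rpow_mul_ann_le x hr a F).trans ?_
  grw [h r hr, ← ofReal_rpow_mul hr]
  exact le_of_eq (by ring)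

theorem volume_ball_eq [NeZero n] (x : Euc n) {r : ℝ} (hr : 0 < r) :
    volume (ball x r) = ENNReal.ofReal r ^ (n : ℝ) * volume (ball (0 : Euc n) 1) := by
  rw [Measure.addHaar_ball_of_pos _ x hr, ENNReal.ofReal_pow hr.le, ENNReal.rpow_natCast]
  simp

theorem volume_unitBall_ne_zero : volume (ball (0 : Euc n) 1) ≠ 0 :=
  (measure_ball_pos _ _ one_pos).ne'

theorem volume_unitBall_ne_top : volume (ball (0 : Euc n) 1) ≠ ⊤ := measure_ball_lt_top.ne

theorem volume_ann_le [NeZero n] (x : Euc n) {r : ℝ} (hr : 0 < r) :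
    volume (ann x r) ≤ ENNReal.ofReal r ^ (n : ℝ) * volume (ball (0 : Euc n) 1) :=
  (measure_mono sdiff_subset).trans (volume_ball_eq x hr).le

theorem le_volume_ann [NeZero n] (x : Euc n) {r : ℝ} (hr : 0 < r) :
    ENNReal.ofReal r ^ (n : ℝ) * (volume (ball (0 : Euc n) 1) / 2) ≤ volume (ann x r) := by
  have hr2 : (0 : ℝ) < 2⁻¹ := by norm_num
  have hn : (1 : ℝ) ≤ n := by exact_mod_cast NeZero.one_le
  rw [ann, measure_sdiff (ball_subset_ball (by linarith)) measurableSet_ball.nullMeasurableSet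
    measure_ball_lt_top.ne]
  -- As n ≥ 1, halving the radius at least halves the volume.
  have h1 : volume (ball x (r / 2)) ≤ volume (ball x r) / 2 := by
    rw [volume_ball_eq x hr, volume_ball_eq x (half_pos hr), div_eq_inv_mul r,
      ofReal_mul_rpow hr2, mul_assoc, ENNReal.div_eq_inv_mul]
    gcongr
    calc ENNReal.ofReal 2⁻¹ ^ (n : ℝ) ≤ ENNReal.ofReal 2⁻¹ ^ (1 : ℝ) :=
          ENNReal.rpow_le_rpow_of_exponent_ge (by simp) hn
      _ = _ := by rw [ENNReal.rpow_one, ENNReal.ofReal_inv_of_pos (by norm_num)]; simp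
  calc _ = volume (ball x r) / 2 := by rw [volume_ball_eq x hr, mul_div_assoc]
    _ = volume (ball x r) - volume (ball x r) / 2 := by
        rw [ENNReal.sub_half measure_ball_lt_top.ne]
    _ ≤ _ := tsub_le_tsub_left h1 _

end LocalMorrey

/-! ### The Hardy-Littlewood maximal theorem -/

namespace LocalMorrey

open Metric Set

variable {n : ℕ}

/-- The supremum is uncountable, but the indicator of an open ball is lower semicontinuous and this
property survives arbitrary suprema. Nothing is required of `φ`. -/
theorem measurable_iSup_ball (φ : Euc n → ℝ → ℝ≥0∞) :
    Measurable fun x => ⨆ (c : Euc n) (r : ℝ) (_ : x ∈ ball c r), φ c r := by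
  refine LowerSemicontinuous.measurable ?_
  refine lowerSemicontinuous_iSup fun c => lowerSemicontinuous_iSup fun r => ?_
  have h : (fun x => ⨆ (_ : x ∈ ball c r), φ c r) = (ball c r).indicator fun _ => φ c r := by
    ext x
    by_cases hx : x ∈ ball c r <;> simp only [hx, iSup_pos, iSup_neg, indicator_of_mem,
      indicator_of_notMem, not_false_eq_true, ENNReal.bot_eq_zero]
  rw [h]
  exact isOpen_ball.lowerSemicontinuous_indicator zero_le

/-- The uncentred Hardy-Littlewood maximal function. -/
noncomputable def maximal (F : Euc n → ℝ≥0∞) (x : Euc n) : ℝ≥0∞ :=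
  ⨆ (c : Euc n) (r : ℝ) (_ : x ∈ ball c r), (∫⁻ y in ball c r, F y) / volume (ball c r)

theorem measurable_maximal (F : Euc n → ℝ≥0∞) : Measurable (maximal F) :=
  measurable_iSup_ball _

theorem setLIntegral_ball_le_maximal [NeZero n] (F : Euc n → ℝ≥0∞) (x : Euc n) {r : ℝ}
    (hr : 0 < r) :
    ∫⁻ y in ball x r, F y ≤
      volume (ball (0 : Euc n) 1) * maximal F x * ENNReal.ofReal r ^ (n : ℝ) := by
  have h : (∫⁻ y in ball x r, F y) / volume (ball x r) ≤ maximal F x :=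
    le_iSup_of_le x (le_iSup_of_le r (le_iSup_of_le (mem_ball_self hr) le_rfl))
  rw [ENNReal.div_le_iff (measure_ball_pos _ _ hr).ne' measure_ball_lt_top.ne] at h
  refine h.trans (le_of_eq ?_)
  rw [volume_ball_eq x hr]
  ring

/-- The maximal function is of weak type `(1, 1)`. -/
theorem maximal_weak_type [NeZero n] (F : Euc n → ℝ≥0∞) {t : ℝ≥0∞} (ht₀ : t ≠ 0) (ht : t ≠ ⊤) :
    t * volume {x | t < maximal F x} ≤ 4 ^ (n : ℝ) * ∫⁻ y, F y := by
  have hn : (0 : ℝ) < n := by exact_mod_cast NeZero.pos n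
  by_cases hF : ∫⁻ y, F y = ⊤
  · rw [hF, ENNReal.mul_top]
    · exact le_top
    · simp
  set v := volume (ball (0 : Euc n) 1) with hv
  have hv₀ : v ≠ 0 := volume_unitBall_ne_zero
  have hv₁ : v ≠ ⊤ := volume_unitBall_ne_top
  let T : Set (Euc n × ℝ) :=
    {a | 0 < a.2 ∧ t * volume (ball a.1 a.2) ≤ ∫⁻ y in ball a.1 a.2, F y}
  -- A ball in `T` of radius r satisfies t v r^n ≤ ∫ F, which bounds the radii as Vitali's lemma
  -- requires. The enlargement factor may be any number above 3; 4 is chosen.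
  have hB : ((∫⁻ y, F y) / (t * v)) ^ (1 / (n : ℝ)) ≠ ⊤ :=
    ENNReal.rpow_ne_top_of_nonneg (by positivity)
      (ENNReal.div_ne_top hF (mul_ne_zero ht₀ hv₀))
  obtain ⟨u, huT, hdisj, hcov⟩ := Vitali.exists_disjoint_subfamily_covering_enlargement_ball T
    (fun a => a.1) (fun a => a.2) (((∫⁻ y, F y) / (t * v)) ^ (1 / (n : ℝ))).toReal
    (fun a ha => by
      rw [← ENNReal.ofReal_le_iff_le_toReal hB, one_div, ENNReal.le_rpow_inv_iff hn,
        ENNReal.le_div_iff_mul_le (Or.inl (mul_ne_zero ht₀ hv₀))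
          (Or.inl (ENNReal.mul_ne_top ht hv₁))]
      calc _ = t * volume (ball a.1 a.2) := by rw [volume_ball_eq _ ha.1]; ring
        _ ≤ _ := ha.2.trans (setLIntegral_le_lintegral _ _))
    4 (by norm_num)
  have hc : u.Countable := hdisj.countable_of_isOpen (fun _ _ => isOpen_ball)
    fun a ha => nonempty_ball.2 (huT ha).1
  have hsub : {x | t < maximal F x} ⊆ ⋃ a ∈ u, ball a.1 (4 * a.2) := by
    intro x hx
    simp only [maximal, mem_ofPred_eq, lt_iSup_iff] at hx
    obtain ⟨c, r, hxr, hlt⟩ := hx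
    have hr : 0 < r := pos_of_mem_ball hxr
    have hT : (c, r) ∈ T := ⟨hr, by
      rw [← ENNReal.le_div_iff_mul_le (Or.inl (measure_ball_pos _ _ hr).ne')
        (Or.inl measure_ball_lt_top.ne)]
      exact hlt.le⟩
    obtain ⟨b, hb, hsub⟩ := hcov _ hT
    exact mem_biUnion hb (hsub hxr)
  calc t * volume {x | t < maximal F x}
      ≤ t * ∑' a : u, volume (ball a.1.1 (4 * a.1.2)) := by
        gcongr
        exact (measure_mono hsub).trans (measure_biUnion_le _ hc _)
    _ = 4 ^ (n : ℝ) * ∑' a : u, t * volume (ball a.1.1 a.1.2) := by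
        rw [← ENNReal.tsum_mul_left, ← ENNReal.tsum_mul_left]
        refine tsum_congr fun a => ?_
        have ha := (huT a.2).1
        rw [volume_ball_eq _ ha, volume_ball_eq _ (by positivity), ofReal_mul_rpow (by norm_num)]
        simp only [ENNReal.ofReal_ofNat]
        ring
    _ ≤ 4 ^ (n : ℝ) * ∑' a : u, ∫⁻ y in ball a.1.1 a.1.2, F y := by
        gcongr with a
        exact (huT a.2).2
    _ = 4 ^ (n : ℝ) * ∫⁻ y in ⋃ a ∈ u, ball a.1 a.2, F y := by
        rw [lintegral_biUnion hc (fun _ _ => measurableSet_ball) hdisj]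
    _ ≤ _ := by
        gcongr
        exact Measure.restrict_le_self

theorem lintegral_indicator_lt_rpow_ofReal (b : ℝ≥0) {s : ℝ} (hs : 0 < s) :
    ∫⁻ t in Ioi (0 : ℝ), {t : ℝ | ENNReal.ofReal t < b}.indicator
      (fun t => ENNReal.ofReal (t ^ (s - 1))) t = (b : ℝ≥0∞) ^ s / ENNReal.ofReal s := by
  have hset : MeasurableSet {t : ℝ | ENNReal.ofReal t < b} :=
    measurableSet_lt ENNReal.measurable_ofReal measurable_const
  have hI : {t : ℝ | ENNReal.ofReal t < b} ∩ Ioi 0 = Ioo 0 (b : ℝ) := by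
    ext t
    simp only [mem_inter_iff, mem_ofPred_eq, mem_Ioi, mem_Ioo]
    constructor
    · rintro ⟨h, h0⟩
      exact ⟨h0, by rwa [← ENNReal.ofReal_coe_nnreal, ENNReal.ofReal_lt_ofReal_iff_of_nonneg h0.le]
        at h⟩
    · rintro ⟨h0, h⟩
      exact ⟨by rwa [← ENNReal.ofReal_coe_nnreal, ENNReal.ofReal_lt_ofReal_iff_of_nonneg h0.le], h0⟩
  rw [lintegral_indicator hset, Measure.restrict_restrict hset, hI,
    setLIntegral_congr Ioo_ae_eq_Ioc, ← ofReal_integral_eq_lintegral_ofReal,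
    ← intervalIntegral.integral_of_le b.coe_nonneg, integral_rpow (Or.inl (by linarith))]
  · rw [sub_add_cancel, Real.zero_rpow hs.ne', sub_zero, ENNReal.ofReal_div_of_pos hs,
      ← ENNReal.ofReal_rpow_of_nonneg b.coe_nonneg hs.le, ENNReal.ofReal_coe_nnreal]
  · exact (intervalIntegrable_iff_integrableOn_Ioc_of_le b.coe_nonneg).1
      (intervalIntegral.intervalIntegrable_rpow' (by linarith))
  · filter_upwards [ae_restrict_mem measurableSet_Ioc] with t ht
    exact Real.rpow_nonneg ht.1.le _

/-- The layer cake formula for a single extended number. -/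
theorem lintegral_indicator_lt_rpow (a : ℝ≥0∞) {s : ℝ} (hs : 0 < s) :
    ∫⁻ t in Ioi (0 : ℝ), {t : ℝ | ENNReal.ofReal t < a}.indicator
      (fun t => ENNReal.ofReal (t ^ (s - 1))) t = a ^ s / ENNReal.ofReal s := by
  rcases eq_or_ne a ⊤ with rfl | ha
  · rw [ENNReal.top_rpow_of_pos hs, ENNReal.top_div_of_ne_top ENNReal.ofReal_ne_top]
    -- For a = `⊤` the integral dominates the one for each finite b; b is taken with b^s / s = r.
    refine ENNReal.eq_top_of_forall_nnreal_le fun r => ?_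
    have h := lintegral_indicator_lt_rpow_ofReal ((r * s.toNNReal) ^ (1 / s)) hs
    rw [← ENNReal.coe_rpow_of_nonneg _ hs.le, ← NNReal.rpow_mul, one_div_mul_cancel hs.ne',
      NNReal.rpow_one, ENNReal.coe_mul, ENNReal.ofReal,
      ENNReal.mul_div_cancel_right (by simpa using hs) (by simp)] at h
    rw [← h]
    refine lintegral_mono fun t => indicator_le_indicator_of_subset ?_ (fun _ => zero_le) t
    intro t _
    simp
  · lift a to ℝ≥0 using ha
    exact lintegral_indicator_lt_rpow_ofReal a hs

/-- F is at most its part above height t plus the constant t, whose averages equal t. This is the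
splitting of Marcinkiewicz interpolation. -/
theorem maximal_le_truncate_add (F : Euc n → ℝ≥0∞) (t : ℝ≥0∞)
    (x : Euc n) : maximal F x ≤ maximal ({y | t < F y}.indicator F) x + t := by
  refine iSup_le fun c => iSup_le fun r => iSup_le fun hx => ?_
  have hr : 0 < r := pos_of_mem_ball hx
  have h : (∫⁻ y in ball c r, {y | t < F y}.indicator F y) / volume (ball c r) ≤
      maximal ({y | t < F y}.indicator F) x :=
    le_iSup_of_le c (le_iSup_of_le r (le_iSup_of_le hx le_rfl))
  grw [← h]
  have : ∫⁻ y in ball c r, F y ≤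
      ∫⁻ y in ball c r, ({y | t < F y}.indicator F y + t) := by
    refine lintegral_mono fun y => ?_
    by_cases hy : t < F y
    · simp [indicator, hy]
    · simp [indicator, hy, not_lt.1 hy]
  grw [this]
  rw [lintegral_add_right _ measurable_const, setLIntegral_const, ENNReal.add_div,
    ENNReal.mul_div_cancel_right (measure_ball_pos _ _ hr).ne' measure_ball_lt_top.ne]

/-- The maximal function is of strong type `(p, p)` for `1 < p`. -/
theorem exists_lintegral_maximal_rpow_le (n : ℕ) [NeZero n] {p : ℝ} (hp : 1 < p) :
    ∃ C : ℝ≥0∞, C ≠ ⊤ ∧ ∀ F : Euc n → ℝ≥0∞, Measurable F →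
      ∫⁻ x, maximal F x ^ p ≤ C * ∫⁻ x, F x ^ p := by
  have hp0 : 0 < p := by linarith
  have hp1 : 0 < p - 1 := by linarith
  refine ⟨ENNReal.ofReal p * (2 * 4 ^ (n : ℝ) * (2 ^ (p - 1) / ENNReal.ofReal (p - 1))), ?_,
    fun F hF => ?_⟩
  · finiteness
  -- If MF > t, then the maximal function of the part of F above t/2 exceeds t/2; the weak (1,1)
  -- bound is applied to that part.
  have key : ∀ t : ℝ, 0 < t → volume {x | ENNReal.ofReal t < maximal F x} *
      ENNReal.ofReal (t ^ (p - 1)) ≤ 2 * 4 ^ (n : ℝ) *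
        ∫⁻ y, F y * {t : ℝ | ENNReal.ofReal t < 2 * F y}.indicator
          (fun t => ENNReal.ofReal (t ^ (p - 1 - 1))) t := by
    intro t ht
    have ht2 : ENNReal.ofReal t / 2 ≠ 0 := by simp [ht]
    have h := maximal_weak_type ({y | ENNReal.ofReal t / 2 < F y}.indicator F)
      (t := ENNReal.ofReal t / 2) ht2 (ENNReal.div_ne_top ENNReal.ofReal_ne_top two_ne_zero)
    have hsub : volume {x | ENNReal.ofReal t < maximal F x} ≤ volume {x | ENNReal.ofReal t / 2 <
        maximal ({y | ENNReal.ofReal t / 2 < F y}.indicator F) x} := by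
      refine measure_mono fun x hx => ?_
      have h1 := lt_of_lt_of_le (mem_ofPred_eq ▸ hx) (maximal_le_truncate_add F (ENNReal.ofReal t / 2) x)
      by_contra hc
      simp only [mem_ofPred_eq, not_lt] at hc
      have := h1.trans_le (add_le_add_left hc _)
      rw [ENNReal.add_halves] at this
      exact lt_irrefl _ this
    have hpow : ENNReal.ofReal (t ^ (p - 1)) =
        2 * (ENNReal.ofReal t / 2) * ENNReal.ofReal (t ^ (p - 1 - 1)) := by
      rw [ENNReal.mul_div_cancel two_ne_zero ENNReal.ofNat_ne_top, ← ENNReal.ofReal_mul ht.le]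
      congr 1
      rw [Real.rpow_sub_one ht.ne' (p - 1)]
      field_simp
    rw [hpow]
    calc _ ≤ volume {x | ENNReal.ofReal t / 2 <
          maximal ({y | ENNReal.ofReal t / 2 < F y}.indicator F) x} *
          (2 * (ENNReal.ofReal t / 2) * ENNReal.ofReal (t ^ (p - 1 - 1))) := by gcongr
      _ = 2 * ENNReal.ofReal (t ^ (p - 1 - 1)) * (ENNReal.ofReal t / 2 * volume
          {x | ENNReal.ofReal t / 2 <
            maximal ({y | ENNReal.ofReal t / 2 < F y}.indicator F) x}) := by ring
      _ ≤ 2 * ENNReal.ofReal (t ^ (p - 1 - 1)) * (4 ^ (n : ℝ) *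
          ∫⁻ y, {y | ENNReal.ofReal t / 2 < F y}.indicator F y) := by gcongr
      _ = 2 * 4 ^ (n : ℝ) * (ENNReal.ofReal (t ^ (p - 1 - 1)) *
          ∫⁻ y, {y | ENNReal.ofReal t / 2 < F y}.indicator F y) := by ring
      _ = _ := by
        rw [← lintegral_const_mul' _ _ ENNReal.ofReal_ne_top]
        congr 2
        ext y
        have : ENNReal.ofReal t / 2 < F y ↔ ENNReal.ofReal t < 2 * F y := by
          rw [mul_comm, ENNReal.div_lt_iff (Or.inl two_ne_zero) (Or.inl ENNReal.ofNat_ne_top)]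
        simp only [indicator, mem_ofPred_eq, this]
        split_ifs
        · ring
        · simp
  have hm : ∀ G : Euc n → ℝ≥0∞, Measurable G → ∀ φ : ℝ → ℝ≥0∞, Measurable φ →
      Measurable fun z : Euc n × ℝ => {t : ℝ | ENNReal.ofReal t < G z.1}.indicator φ z.2 := by
    intro G hG φ hφ
    have : (fun z : Euc n × ℝ => {t : ℝ | ENNReal.ofReal t < G z.1}.indicator φ z.2) =
        {z : Euc n × ℝ | ENNReal.ofReal z.2 < G z.1}.indicator fun z => φ z.2 := by
      ext z; simp [indicator]
    rw [this]
    exact (hφ.comp measurable_snd).indicator (measurableSet_lt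
      (ENNReal.measurable_ofReal.comp measurable_snd) (hG.comp measurable_fst))
  have hmp : ∀ s : ℝ, Measurable fun t : ℝ => ENNReal.ofReal (t ^ s) := fun s =>
    ENNReal.measurable_ofReal.comp (measurable_id.pow_const s)
  -- Layer cake, Tonelli, the weak bound, and Tonelli again. The remaining integral of t^(p-2) over
  -- 0 < t < 2F(y) is finite for finite F(y) because p > 1.
  calc ∫⁻ x, maximal F x ^ p
      = ENNReal.ofReal p * ∫⁻ x, ∫⁻ t in Ioi (0 : ℝ),
          {t : ℝ | ENNReal.ofReal t < maximal F x}.indicator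
            (fun t => ENNReal.ofReal (t ^ (p - 1))) t := by
        rw [← lintegral_const_mul' _ _ ENNReal.ofReal_ne_top]
        congr 1
        ext x
        rw [lintegral_indicator_lt_rpow _ hp0, ENNReal.mul_div_cancel (by simpa using hp0)
          ENNReal.ofReal_ne_top]
    _ = ENNReal.ofReal p * ∫⁻ t in Ioi (0 : ℝ), ∫⁻ x,
          {t : ℝ | ENNReal.ofReal t < maximal F x}.indicator
            (fun t => ENNReal.ofReal (t ^ (p - 1))) t := by
        rw [lintegral_lintegral_swap]
        exact (hm _ (measurable_maximal F) _ (hmp _)).aemeasurable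
    _ ≤ ENNReal.ofReal p * ∫⁻ t in Ioi (0 : ℝ), 2 * 4 ^ (n : ℝ) *
        ∫⁻ y, F y * {t : ℝ | ENNReal.ofReal t < 2 * F y}.indicator
          (fun t => ENNReal.ofReal (t ^ (p - 1 - 1))) t := by
        gcongr ENNReal.ofReal p * ?_
        refine setLIntegral_mono' measurableSet_Ioi fun t ht => le_trans (le_of_eq ?_) (key t ht)
        have : (fun x => {t : ℝ | ENNReal.ofReal t < maximal F x}.indicator
            (fun t => ENNReal.ofReal (t ^ (p - 1))) t) =
            {x | ENNReal.ofReal t < maximal F x}.indicator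
              fun _ => ENNReal.ofReal (t ^ (p - 1)) := by
          ext x; simp [indicator]
        rw [this, lintegral_indicator_const (measurableSet_lt measurable_const
          (measurable_maximal F)), mul_comm]
    _ = ENNReal.ofReal p * (2 * 4 ^ (n : ℝ) * ∫⁻ y, F y * ((2 * F y) ^ (p - 1) /
          ENNReal.ofReal (p - 1))) := by
        rw [lintegral_const_mul' _ _ (by finiteness), ← lintegral_lintegral_swap]
        · congr 3
          ext y
          have hmy : Measurable fun t : ℝ => {t : ℝ | ENNReal.ofReal t < 2 * F y}.indicator
              (fun t => ENNReal.ofReal (t ^ (p - 1 - 1))) t :=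
            (hmp _).indicator (measurableSet_lt ENNReal.measurable_ofReal measurable_const)
          rw [lintegral_const_mul _ hmy, lintegral_indicator_lt_rpow _ hp1]
        · exact ((hF.comp measurable_fst).mul (hm _ (hF.const_mul 2) _ (hmp _))).aemeasurable
    _ = _ := by
        rw [mul_assoc (ENNReal.ofReal p), mul_assoc (2 * 4 ^ (n : ℝ)),
          ← lintegral_const_mul' (2 ^ (p - 1) / ENNReal.ofReal (p - 1)) _ (by finiteness)]
        congr 3
        ext y
        rw [ENNReal.mul_rpow_of_nonneg _ _ hp1.le]
        have : F y ^ p = F y * F y ^ (p - 1) := by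
          conv_rhs => rw [← ENNReal.rpow_one (F y), ← ENNReal.rpow_mul, one_mul,
            ← ENNReal.rpow_add_of_nonneg _ _ zero_le_one hp1.le]
          ring_nf
        rw [this]
        simp only [div_eq_mul_inv]
        ring

end LocalMorrey

/-! ### Hedberg's inequality and the truncated fractional integral -/

namespace LocalMorrey

open Metric Set

variable {n : ℕ}

theorem rpow_one_div_rpow (x : ℝ≥0∞) {q : ℝ} (hq : q ≠ 0) : (x ^ (1 / q)) ^ q = x := by
  rw [← ENNReal.rpow_mul, one_div_mul_cancel hq, ENNReal.rpow_one]

theorem rpow_div_rpow (x : ℝ≥0∞) (p : ℝ) {q : ℝ} (hq : q ≠ 0) : (x ^ (p / q)) ^ q = x ^ p := by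
  rw [← ENNReal.rpow_mul, div_mul_cancel₀ _ hq]

theorem setLIntegral_le_rpow_mul_measure {p : ℝ} (hp : 1 ≤ p) (S : Set (Euc n))
    {F : Euc n → ℝ≥0∞} (hF : Measurable F) :
    ∫⁻ y in S, F y ≤ (∫⁻ y in S, F y ^ p) ^ (1 / p) * volume S ^ (1 - 1 / p) := by
  rcases hp.eq_or_lt with rfl | hp
  · simp
  have h := ENNReal.lintegral_mul_le_Lp_mul_Lq (volume.restrict S)
    (Real.HolderConjugate.conjExponent hp) hF.aemeasurable
    (aemeasurable_const (b := (1 : ℝ≥0∞)))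
  have h1 : 1 / Real.conjExponent p = 1 - 1 / p := by
    rw [Real.conjExponent, one_div_div]
    field_simp
  simpa [h1] using h

theorem lintegral_eq_zero_of_rpow {p : ℝ} (hp : 0 < p) {F : Euc n → ℝ≥0∞} (hF : Measurable F)
    (h : ∫⁻ y, F y ^ p = 0) : F =ᵐ[volume] 0 := by
  rw [lintegral_eq_zero_iff (hF.pow_const p)] at h
  filter_upwards [h] with y hy
  simpa [ENNReal.rpow_eq_zero_iff, hp, hp.le, not_lt.2 hp.le] using hy

/-- Exponent bookkeeping for Hedberg's choice of radius, a power of T/M. -/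
theorem div_rpow_mul_eq {T M : ℝ≥0∞} (hT₀ : T ≠ 0) (hT : T ≠ ⊤) (hM₀ : M ≠ 0) (hM : M ≠ ⊤)
    (s a b : ℝ) : (T / M) ^ s * (T ^ a * M ^ b) = M ^ (b - s) * T ^ (s + a) := by
  rw [div_eq_mul_inv, ENNReal.mul_rpow_of_ne_top hT (by simpa using hM₀), ENNReal.inv_rpow,
    ← ENNReal.rpow_neg, sub_eq_add_neg, ENNReal.rpow_add _ _ hM₀ hM, ENNReal.rpow_add _ _ hT₀ hT]
  ring

/-- Within distance R the surplus of a over b costs at most R^(a-b). Applied with a = α-n and b =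
γ-n, it reduces order α to order γ. At y = x the right side is `⊤`, as b < 0. -/
theorem enorm_rpow_le_mul {x y : Euc n} {R a b : ℝ} (hab : b ≤ a) (hb : b < 0)
    (h : y ∈ ball x R) :
    ‖x - y‖ₑ ^ a ≤ ENNReal.ofReal R ^ (a - b) * ‖x - y‖ₑ ^ b := by
  have hR : 0 < R := pos_of_mem_ball h
  rw [enorm_sub_eq_ofReal_dist]
  rcases (dist_nonneg (x := y) (y := x)).eq_or_lt' with h0 | h0
  · rw [h0, ENNReal.ofReal_zero, ENNReal.zero_rpow_of_neg hb, ENNReal.mul_top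
      (ofReal_rpow_ne_zero hR _)]
    exact le_top
  · rw [show a = a - b + b by ring, ← ofReal_rpow_mul h0, show a - b + b - b = a - b by ring]
    gcongr
    exact (mem_ball.1 h).le

/-- Hedberg's pointwise inequality for the truncated fractional integral. -/
theorem exists_truncated_fracIntegral_le_maximal (n : ℕ) [NeZero n] {α γ p q : ℝ}
    (hα : 0 < α) (hγ : 0 ≤ γ) (hγα : γ ≤ α) (hp : 1 ≤ p) (hpγ : p * γ < n)
    (hpq : 1 / p - 1 / q = γ / n) (hq : 0 < q) :
    ∃ C : ℝ≥0∞, C ≠ ⊤ ∧ ∀ F : Euc n → ℝ≥0∞, Measurable F → ∫⁻ y, F y ^ p ≠ ⊤ →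
      ∀ (x : Euc n) (R : ℝ), 0 < R → ∫⁻ y in ball x R, ‖x - y‖ₑ ^ (α - n) * F y ≤
        C * (ENNReal.ofReal R ^ (α - γ) * (maximal F x ^ (p / q) *
          ((∫⁻ y, F y ^ p) ^ (1 / p)) ^ (1 - p / q))) := by
  have hn : (0 : ℝ) < n := by exact_mod_cast NeZero.pos n
  have hp0 : 0 < p := by linarith
  set v := volume (ball (0 : Euc n) 1) with hv
  have hv₁ : v ≠ ⊤ := volume_unitBall_ne_top
  have hpq' : p / q = 1 - p * γ / n := by
    have : p * (1 / p - 1 / q) = p * (γ / n) := by rw [hpq]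
    field_simp at this ⊢
    linarith
  have hpq0 : 0 < p / q := by positivity
  -- Each annulus around x carries at most a multiple of r^n MF(x), so the sum has terms r^a.
  have near : ∀ (a : ℝ) (F : Euc n → ℝ≥0∞) (x : Euc n) (R : ℝ), 0 < R →
      ∫⁻ y in ball x R, ‖x - y‖ₑ ^ (a - n) * F y ≤ (1 - (2 : ℝ≥0∞) ^ (-a))⁻¹ *
        (2 ^ |a - n| * (v * maximal F x) * ENNReal.ofReal R ^ a) := by
    intro a F x R hR
    have h := setLIntegral_rpow_mul_ball_le x (a := a - n) (b := n) (K := v * maximal F x) (F := F)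
      (fun r hr => (lintegral_mono_set sdiff_subset).trans
        (setLIntegral_ball_le_maximal F x hr)) hR
    simpa using h
  -- Hölder on annuli gives terms r^(γ-n/p), summable at infinity because pγ < n.
  have far : ∀ (F : Euc n → ℝ≥0∞), Measurable F → ∀ (x : Euc n) (R : ℝ), 0 < R →
      ∫⁻ y in (ball x R)ᶜ, ‖x - y‖ₑ ^ (γ - n) * F y ≤ (1 - (2 : ℝ≥0∞) ^ (γ - n / p))⁻¹ *
        (2 ^ |γ - n| * ((∫⁻ y, F y ^ p) ^ (1 / p) * v ^ (1 - 1 / p)) *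
          ENNReal.ofReal R ^ (γ - n / p)) := by
    intro F hF x R hR
    have hneg : γ - n / p < 0 := by
      rw [sub_neg, lt_div_iff₀ hp0]; linarith
    have hexp : γ - n + n * (1 - 1 / p) = γ - n / p := by ring
    have h := setLIntegral_rpow_mul_compl_ball_le x (a := γ - n) (b := n * (1 - 1 / p))
      (K := (∫⁻ y, F y ^ p) ^ (1 / p) * v ^ (1 - 1 / p)) (F := F) (by rw [hexp]; exact hneg)
      (fun r hr => by
        have h1 : 0 ≤ 1 - 1 / p := by rw [sub_nonneg, div_le_one hp0]; exact hp
        grw [setLIntegral_le_rpow_mul_measure hp _ hF, volume_ann_le x hr,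
          setLIntegral_le_lintegral]
        rw [ENNReal.mul_rpow_of_nonneg _ _ h1, ← ENNReal.rpow_mul, hv]
        exact le_of_eq (by ring)) hR
    rwa [hexp] at h
  -- For γ = 0 the second geometric constant is `⊤`; the `if` removes it, that case needing only the
  -- first term. The final 1 keeps the constant nonzero, so the bound is trivial when MF(x) = `⊤`.
  refine ⟨(1 - (2 : ℝ≥0∞) ^ (-α))⁻¹ * (2 ^ |α - n| * v) + (1 - (2 : ℝ≥0∞) ^ (-γ))⁻¹ *
    (if γ = 0 then 0 else 2 ^ |γ - n| * v) +
    (1 - (2 : ℝ≥0∞) ^ (γ - n / p))⁻¹ * (2 ^ |γ - n| * v ^ (1 - 1 / p)) + 1, ?_, ?_⟩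
  · have h1 := geometric_ne_top hα
    have h2 : (1 - (2 : ℝ≥0∞) ^ (γ - n / p))⁻¹ ≠ ⊤ := by
      have := geometric_ne_top (b := n / p - γ) (by rw [sub_pos, lt_div_iff₀ hp0]; linarith)
      simpa using this
    have h3 : (1 - (2 : ℝ≥0∞) ^ (-γ))⁻¹ * (if γ = 0 then 0 else 2 ^ |γ - n| * v) ≠ ⊤ := by
      split_ifs with h
      · simp
      · have h3 := geometric_ne_top (lt_of_le_of_ne hγ (Ne.symm h))
        finiteness
    have h4 : 0 ≤ 1 - 1 / p := by rw [sub_nonneg, div_le_one hp0]; exact hp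
    finiteness
  intro F hF hT x R hR
  have hT1 : (∫⁻ y, F y ^ p) ^ (1 / p) ≠ ⊤ := ENNReal.rpow_ne_top_of_nonneg (by positivity) hT
  set T := (∫⁻ y, F y ^ p) ^ (1 / p) with hTdef
  set M := maximal F x with hM
  rcases eq_or_ne T 0 with hT0 | hT0
  · have h0 : ∫⁻ y, F y ^ p = 0 := by
      simpa [hTdef, ENNReal.rpow_eq_zero_iff, hp0, not_lt.2 hp0.le] using hT0
    have h1 := lintegral_eq_zero_of_rpow hp0 hF h0
    have : ∫⁻ y in ball x R, ‖x - y‖ₑ ^ (α - n) * F y = 0 := by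
      rw [lintegral_congr_ae (g := fun _ => 0)]
      · simp
      · filter_upwards [ae_restrict_of_ae h1] with y hy
        simp [hy]
    rw [this]; exact zero_le
  rcases eq_or_ne M 0 with hM0 | hM0
  · refine (near α F x R hR).trans ?_
    rw [← hM, hM0]
    simp
  rcases eq_or_ne M ⊤ with hMt | hMt
  · rw [hMt, ENNReal.top_rpow_of_pos hpq0, ENNReal.top_mul, ENNReal.mul_top, ENNReal.mul_top]
    · exact le_top
    · simp
    · exact ofReal_rpow_ne_zero hR _
    · simp [ENNReal.rpow_eq_zero_iff, hT0, hT1]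
  -- Here p = q, and the near bound with exponent α over the whole ball suffices.
  rcases hγ.eq_or_lt' with rfl | hγ0
  · have hpq1 : p / q = 1 := by simp [hpq']
    rw [hpq1, ENNReal.rpow_one, sub_self, ENNReal.rpow_zero, mul_one, sub_zero]
    refine (near α F x R hR).trans ?_
    rw [show (1 - (2 : ℝ≥0∞) ^ (-α))⁻¹ * (2 ^ |α - n| * (v * maximal F x) *
      ENNReal.ofReal R ^ α) = (1 - (2 : ℝ≥0∞) ^ (-α))⁻¹ * (2 ^ |α - n| * v) *
      (ENNReal.ofReal R ^ α * M) by ring]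
    gcongr
    rw [add_assoc, add_assoc]
    exact le_self_add
  · have hγn : γ - n < 0 := by nlinarith
    -- The radius that balances both bounds: δ^γ M = δ^(γ-n/p) T when δ^(n/p) = T/M. Their common
    -- value is M^(p/q) T^(1-p/q).
    set δ := ((T / M) ^ (p / n)).toReal with hδdef
    have hδ : ENNReal.ofReal δ = (T / M) ^ (p / n) :=
      ENNReal.ofReal_toReal (ENNReal.rpow_ne_top_of_nonneg (by positivity)
        (ENNReal.div_ne_top hT1 hM0))
    have hTM0 : T / M ≠ 0 := by simp [hT0, hMt]
    have hδ0 : 0 < δ := by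
      rw [← ENNReal.ofReal_pos, hδ]
      exact ENNReal.rpow_pos (pos_iff_ne_zero.2 hTM0) (ENNReal.div_ne_top hT1 hM0)
    have e1 : ENNReal.ofReal δ ^ γ * M = M ^ (p / q) * T ^ (1 - p / q) := by
      have := div_rpow_mul_eq hT0 hT1 hM0 hMt (p / n * γ) 0 1
      rw [hδ, ← ENNReal.rpow_mul, hpq']
      simp only [ENNReal.rpow_zero, ENNReal.rpow_one, one_mul] at this
      rw [this]; congr 2 <;> ring
    have e2 : ENNReal.ofReal δ ^ (γ - n / p) * T = M ^ (p / q) * T ^ (1 - p / q) := by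
      have := div_rpow_mul_eq hT0 hT1 hM0 hMt (p / n * (γ - n / p)) 1 0
      rw [hδ, ← ENNReal.rpow_mul, hpq']
      simp only [ENNReal.rpow_zero, ENNReal.rpow_one, mul_one] at this
      rw [this]; congr 2 <;> field_simp <;> ring
    calc ∫⁻ y in ball x R, ‖x - y‖ₑ ^ (α - n) * F y
        ≤ ∫⁻ y in ball x R, ENNReal.ofReal R ^ (α - γ) * (‖x - y‖ₑ ^ (γ - n) * F y) := by
          refine setLIntegral_mono' measurableSet_ball fun y hy => ?_
          have := enorm_rpow_le_mul (a := α - n) (b := γ - n) (by linarith) hγn hy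
          rw [← mul_assoc]
          gcongr
          simpa using this
      _ = ENNReal.ofReal R ^ (α - γ) * ∫⁻ y in ball x R, ‖x - y‖ₑ ^ (γ - n) * F y :=
          lintegral_const_mul' _ _ (ofReal_rpow_ne_top hR _)
      _ ≤ ENNReal.ofReal R ^ (α - γ) * ((∫⁻ y in ball x δ, ‖x - y‖ₑ ^ (γ - n) * F y) +
            ∫⁻ y in (ball x δ)ᶜ, ‖x - y‖ₑ ^ (γ - n) * F y) := by
          gcongr
          rw [lintegral_add_compl _ measurableSet_ball]
          exact setLIntegral_le_lintegral _ _
      _ ≤ ENNReal.ofReal R ^ (α - γ) * ((1 - (2 : ℝ≥0∞) ^ (-γ))⁻¹ *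
            (2 ^ |γ - n| * (v * M) * ENNReal.ofReal δ ^ γ) +
            (1 - (2 : ℝ≥0∞) ^ (γ - n / p))⁻¹ *
              (2 ^ |γ - n| * (T * v ^ (1 - 1 / p)) * ENNReal.ofReal δ ^ (γ - n / p))) := by
          gcongr
          · exact near γ F x δ hδ0
          · exact far F hF x δ hδ0
      _ = ENNReal.ofReal R ^ (α - γ) * ((1 - (2 : ℝ≥0∞) ^ (-γ))⁻¹ *
            (2 ^ |γ - n| * v) * (ENNReal.ofReal δ ^ γ * M) +
            (1 - (2 : ℝ≥0∞) ^ (γ - n / p))⁻¹ *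
              (2 ^ |γ - n| * v ^ (1 - 1 / p)) * (ENNReal.ofReal δ ^ (γ - n / p) * T)) := by ring
      _ = ((1 - (2 : ℝ≥0∞) ^ (-γ))⁻¹ * (2 ^ |γ - n| * v) +
            (1 - (2 : ℝ≥0∞) ^ (γ - n / p))⁻¹ * (2 ^ |γ - n| * v ^ (1 - 1 / p))) *
            (ENNReal.ofReal R ^ (α - γ) * (M ^ (p / q) * T ^ (1 - p / q))) := by
          rw [e1, e2]; ring
      _ ≤ _ := by
          gcongr ?_ * _
          rw [if_neg hγ0.ne', add_assoc (_ * (_ * _))]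
          exact le_add_right le_add_self

/-- The q-th power of Hedberg's bound contains (MF)^p, to which the strong maximal theorem applies;
the powers of the L^p norm recombine through (1-p/q) + p/q = 1. -/
theorem exists_lintegral_truncated_fracIntegral_rpow_le (n : ℕ) [NeZero n] {α γ p q : ℝ}
    (hα : 0 < α) (hγ : 0 ≤ γ) (hγα : γ ≤ α) (hp : 1 < p) (hpγ : p * γ < n)
    (hpq : 1 / p - 1 / q = γ / n) (hq : 0 < q) :
    ∃ C : ℝ≥0∞, C ≠ ⊤ ∧ ∀ F : Euc n → ℝ≥0∞, Measurable F → ∫⁻ y, F y ^ p ≠ ⊤ →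
      ∀ R : ℝ, 0 < R → ∫⁻ x, (∫⁻ y in ball x R, ‖x - y‖ₑ ^ (α - n) * F y) ^ q ≤
        (C * (ENNReal.ofReal R ^ (α - γ) * (∫⁻ y, F y ^ p) ^ (1 / p))) ^ q := by
  have hp0 : 0 < p := by linarith
  have hn : (0 : ℝ) < n := by exact_mod_cast NeZero.pos n
  have hpq1 : 0 ≤ 1 - p / q := by
    have h1 : 0 ≤ p * (1 / p - 1 / q) := by rw [hpq]; positivity
    have h2 : p * (1 / p - 1 / q) = 1 - p / q := by field_simp
    linarith
  obtain ⟨C, hC, h⟩ := exists_truncated_fracIntegral_le_maximal n hα hγ hγα hp.le hpγ hpq hq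
  obtain ⟨C', hC', h'⟩ := exists_lintegral_maximal_rpow_le n hp
  refine ⟨C * C' ^ (1 / q), by finiteness, fun F hF hT R hR => ?_⟩
  have hT1 : (∫⁻ y, F y ^ p) ^ (1 / p) ≠ ⊤ := ENNReal.rpow_ne_top_of_nonneg (by positivity) hT
  set T := (∫⁻ y, F y ^ p) ^ (1 / p) with hTdef
  have hTp : ∫⁻ y, F y ^ p = T ^ p := by
    rw [hTdef, rpow_one_div_rpow _ hp0.ne']
  calc ∫⁻ x, (∫⁻ y in ball x R, ‖x - y‖ₑ ^ (α - n) * F y) ^ q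
      ≤ ∫⁻ x, (C * (ENNReal.ofReal R ^ (α - γ) * T ^ (1 - p / q))) ^ q * maximal F x ^ p := by
        refine lintegral_mono fun x => ?_
        grw [h F hF hT x R hR]
        rw [show C * (ENNReal.ofReal R ^ (α - γ) * (maximal F x ^ (p / q) * T ^ (1 - p / q))) =
          (C * (ENNReal.ofReal R ^ (α - γ) * T ^ (1 - p / q))) * maximal F x ^ (p / q) by ring,
          ENNReal.mul_rpow_of_nonneg _ _ hq.le, ← ENNReal.rpow_mul (maximal F x),
          div_mul_cancel₀ _ hq.ne']
    _ = (C * (ENNReal.ofReal R ^ (α - γ) * T ^ (1 - p / q))) ^ q * ∫⁻ x, maximal F x ^ p :=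
        lintegral_const_mul _ ((measurable_maximal F).pow_const p)
    _ ≤ (C * (ENNReal.ofReal R ^ (α - γ) * T ^ (1 - p / q))) ^ q * (C' * T ^ p) := by
        grw [h' F hF, hTp]
    _ = (C * (ENNReal.ofReal R ^ (α - γ) * T ^ (1 - p / q))) ^ q *
          (C' ^ (1 / q) * T ^ (p / q)) ^ q := by
        rw [ENNReal.mul_rpow_of_nonneg _ (T ^ (p / q)) hq.le, rpow_one_div_rpow _ hq.ne',
          rpow_div_rpow _ _ hq.ne']
    _ = _ := by
        rw [← ENNReal.mul_rpow_of_nonneg _ _ hq.le]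
        congr 1
        have : T = T ^ (1 - p / q) * T ^ (p / q) := by
          rw [← ENNReal.rpow_add_of_nonneg _ _ hpq1 (by positivity)]
          simp
        conv_rhs => rw [this]
        ring

/-- With `D` the factor of (MF)^(1/q) in Hedberg's bound, a value above t forces MF > (t/D)^q, and
the weak (1,1) bound finishes. -/
theorem exists_rpow_mul_volume_truncated_fracIntegral_le (n : ℕ) [NeZero n] {α γ q : ℝ}
    (hα : 0 < α) (hγ : 0 ≤ γ) (hγα : γ ≤ α) (hγn : 1 * γ < n)
    (hpq : 1 / 1 - 1 / q = γ / n) (hq : 0 < q) :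
    ∃ C : ℝ≥0∞, C ≠ ⊤ ∧ ∀ F : Euc n → ℝ≥0∞, Measurable F → ∫⁻ y, F y ≠ ⊤ →
      ∀ R : ℝ, 0 < R → ∀ t : ℝ≥0∞, t ≠ 0 → t ≠ ⊤ →
        t ^ q * volume {x | t < ∫⁻ y in ball x R, ‖x - y‖ₑ ^ (α - n) * F y} ≤
          (C * (ENNReal.ofReal R ^ (α - γ) * ∫⁻ y, F y)) ^ q := by
  have hn : (0 : ℝ) < n := by exact_mod_cast NeZero.pos n
  have hpq1 : 0 ≤ 1 - 1 / q := by
    have : 0 ≤ γ / n := by positivity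
    rw [← hpq] at this; simpa using this
  obtain ⟨C, hC, h⟩ := exists_truncated_fracIntegral_le_maximal n hα hγ hγα le_rfl hγn hpq hq
  refine ⟨C * (4 ^ (n : ℝ)) ^ (1 / q), by finiteness, fun F hF hT R hR t ht₀ ht => ?_⟩
  have h := h F hF (by simpa using hT)
  simp only [ENNReal.rpow_one, div_one] at h
  set T := ∫⁻ y, F y with hTdef
  set D := C * (ENNReal.ofReal R ^ (α - γ) * T ^ (1 - 1 / q)) with hD
  have hDt : D ≠ ⊤ := by
    have := ofReal_rpow_ne_top hR (α - γ)
    finiteness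
  rcases eq_or_ne D 0 with hD0 | hD0
  · have : {x | t < ∫⁻ y in ball x R, ‖x - y‖ₑ ^ (α - n) * F y} = ∅ := by
      ext x
      simp only [mem_ofPred_eq, mem_empty_iff_false, iff_false, not_lt]
      refine (h x R hR).trans (le_trans (le_of_eq ?_) zero_le)
      rw [show C * (ENNReal.ofReal R ^ (α - γ) * (maximal F x ^ (1 / q) * T ^ (1 - 1 / q))) =
        D * maximal F x ^ (1 / q) by rw [hD]; ring, hD0, zero_mul]
    rw [this]; simp
  have hsub : {x | t < ∫⁻ y in ball x R, ‖x - y‖ₑ ^ (α - n) * F y} ⊆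
      {x | (t / D) ^ q < maximal F x} := by
    intro x hx
    simp only [mem_ofPred_eq] at hx ⊢
    have h1 := hx.trans_le (h x R hR)
    rw [show C * (ENNReal.ofReal R ^ (α - γ) * (maximal F x ^ (1 / q) * T ^ (1 - 1 / q))) =
      maximal F x ^ (1 / q) * D by rw [hD]; ring,
      ← ENNReal.div_lt_iff (Or.inl hD0) (Or.inl hDt), one_div, ENNReal.lt_rpow_inv_iff hq] at h1
    exact h1
  have hw := maximal_weak_type F (t := (t / D) ^ q)
    (by simp [ENNReal.rpow_eq_zero_iff, ht₀, hDt, hq, not_lt.2 hq.le])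
    (ENNReal.rpow_ne_top_of_nonneg hq.le (ENNReal.div_ne_top ht hD0))
  have htD : t ^ q = D ^ q * (t / D) ^ q := by
    rw [← ENNReal.mul_rpow_of_nonneg _ _ hq.le, ENNReal.mul_div_cancel hD0 hDt]
  grw [hsub, htD, mul_assoc, hw]
  rw [← hTdef]
  have e : 4 ^ (n : ℝ) * T = ((4 ^ (n : ℝ)) ^ (1 / q) * T ^ (1 / q)) ^ q := by
    rw [ENNReal.mul_rpow_of_nonneg _ _ hq.le, rpow_one_div_rpow _ hq.ne',
      rpow_one_div_rpow _ hq.ne']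
  rw [e, ← ENNReal.mul_rpow_of_nonneg _ _ hq.le, hD]
  refine le_of_eq ?_
  congr 1
  have : T = T ^ (1 - 1 / q) * T ^ (1 / q) := by
    rw [← ENNReal.rpow_add_of_nonneg _ _ hpq1 (by positivity)]
    simp
  conv_rhs => rw [this]
  ring

end LocalMorrey

/-! ### Morrey norms in terms of dyadic annuli -/

namespace LocalMorrey

open Metric Set

variable {n : ℕ} {ε ε' : Type*} [ENorm ε] [ENorm ε']

/-- The origin must be excluded: for β < 0 the real power vanishes there while the extended one is
`⊤`. A null set, so integrals do not see it. -/
theorem ofReal_weightPow_powerWeight {β p : ℝ} {x : Euc n} (hx : x ≠ 0) :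
    ENNReal.ofReal (weightPow (powerWeight β) p x) = ‖x‖ₑ ^ (β * p) := by
  have h : 0 < ‖x‖ := norm_pos_iff.2 hx
  rw [weightPow, powerWeight, ← Real.rpow_mul h.le, ← ENNReal.ofReal_rpow_of_pos h, ofReal_norm]

theorem ae_ne [NeZero n] (a : Euc n) : ∀ᵐ x : Euc n, x ≠ a := by
  simp [ae_iff]

theorem setLIntegral_mul_weight [NeZero n] (β p : ℝ) (S : Set (Euc n)) (F : Euc n → ℝ≥0∞) :
    ∫⁻ x in S, F x * ENNReal.ofReal (weightPow (powerWeight β) p x) =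
      ∫⁻ x in S, ‖0 - x‖ₑ ^ (β * p) * F x := by
  refine lintegral_congr_ae ?_
  filter_upwards [ae_restrict_of_ae (ae_ne (0 : Euc n))] with x hx
  rw [ofReal_weightPow_powerWeight hx, mul_comm, zero_sub, enorm_neg]

theorem rpow_mul_setLIntegral_ann_le (x : Euc n) {r : ℝ} (hr : 0 < r) (a : ℝ)
    (F : Euc n → ℝ≥0∞) :
    ENNReal.ofReal r ^ a * ∫⁻ y in ann x r, F y ≤
      2 ^ |a| * ∫⁻ y in ann x r, ‖x - y‖ₑ ^ a * F y := by
  rw [← lintegral_const_mul' _ _ (ofReal_rpow_ne_top hr a),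
    ← lintegral_const_mul' _ _ (by simp)]
  refine setLIntegral_mono' (measurableSet_ann x r) fun y hy => ?_
  rw [mem_ann] at hy
  rw [enorm_sub_eq_ofReal_dist, ← mul_assoc]
  gcongr
  exact le_rpow_dyadic hr hy.1 hy.2.le a

theorem exists_mass_ball_le (n : ℕ) [NeZero n] {β p : ℝ} (h : 0 < β * p + n) :
    ∃ C : ℝ≥0∞, C ≠ ⊤ ∧ ∀ r : ℝ, 0 < r →
      mass (n := n) (weightPow (powerWeight β) p) (ball 0 r) ≤
        C * ENNReal.ofReal r ^ (β * p + n) := by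
  refine ⟨(1 - (2 : ℝ≥0∞) ^ (-(β * p + n)))⁻¹ * (2 ^ |β * p| * volume (ball (0 : Euc n) 1)), ?_,
    fun r hr => ?_⟩
  · have h1 := geometric_ne_top h
    have h2 : volume (ball (0 : Euc n) 1) ≠ ⊤ := volume_unitBall_ne_top
    finiteness
  have h1 := setLIntegral_mul_weight (n := n) β p (ball 0 r) fun _ => 1
  simp only [one_mul] at h1
  rw [mass, h1]
  refine (setLIntegral_rpow_mul_ball_le 0 (b := n) (K := volume (ball (0 : Euc n) 1))
    (fun s hs => ?_) hr).trans (le_of_eq (by ring))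
  rw [setLIntegral_one, mul_comm]
  exact volume_ann_le 0 hs

/-- The outermost annulus alone has enough mass, so no sign condition on βp+n is needed. -/
theorem exists_le_mass_ball (n : ℕ) [NeZero n] (β p : ℝ) :
    ∃ C : ℝ≥0∞, C ≠ ⊤ ∧ ∀ r : ℝ, 0 < r → ENNReal.ofReal r ^ (β * p + n) ≤
      C * mass (n := n) (weightPow (powerWeight β) p) (ball 0 r) := by
  have hv₀ : volume (ball (0 : Euc n) 1) / 2 ≠ 0 := by simp [volume_unitBall_ne_zero]
  have hv₁ : volume (ball (0 : Euc n) 1) / 2 ≠ ⊤ :=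
    ENNReal.div_ne_top volume_unitBall_ne_top two_ne_zero
  refine ⟨(volume (ball (0 : Euc n) 1) / 2)⁻¹ * 2 ^ |β * p|, by finiteness, fun r hr => ?_⟩
  have h1 := setLIntegral_mul_weight (n := n) β p (ball 0 r) fun _ => 1
  simp only [one_mul] at h1
  have h2 := rpow_mul_setLIntegral_ann_le (n := n) 0 hr (β * p) fun _ => 1
  rw [setLIntegral_one] at h2
  calc ENNReal.ofReal r ^ (β * p + n)
      = (volume (ball (0 : Euc n) 1) / 2)⁻¹ * (ENNReal.ofReal r ^ (β * p) *
        (ENNReal.ofReal r ^ (n : ℝ) * (volume (ball (0 : Euc n) 1) / 2))) := by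
        rw [← ofReal_rpow_mul hr, ← mul_assoc (ENNReal.ofReal r ^ (β * p)),
          mul_comm (volume (ball (0 : Euc n) 1) / 2)⁻¹, mul_assoc _ (volume _ / 2),
          ENNReal.mul_inv_cancel hv₀ hv₁, mul_one]
    _ ≤ (volume (ball (0 : Euc n) 1) / 2)⁻¹ *
          (2 ^ |β * p| * ∫⁻ y in ann (0 : Euc n) r, ‖0 - y‖ₑ ^ (β * p) * 1) := by
        grw [le_volume_ann 0 hr, h2]
    _ ≤ (volume (ball (0 : Euc n) 1) / 2)⁻¹ *
          (2 ^ |β * p| * ∫⁻ y in ball (0 : Euc n) r, ‖0 - y‖ₑ ^ (β * p) * 1) := by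
        gcongr
        exact sdiff_subset
    _ = _ := by rw [mass, h1, mul_assoc]

/-- Functions in the Morrey space have controlled `L^p` norm on annuli. -/
theorem exists_ann_le_normKS (n : ℕ) [NeZero n] {p l β : ℝ} (hp : 0 < p) (hl : 0 < l)
    (h : 0 < β * p + n) :
    ∃ C : ℝ≥0∞, C ≠ ⊤ ∧ ∀ {ε : Type*} [ENorm ε] (g : Euc n → ε) (R : ℝ), 0 < R →
      ∫⁻ x in ann 0 R, ‖g x‖ₑ ^ p ≤ (C * normKS p l β g *
        ENNReal.ofReal R ^ (n / p - (n - l) * (1 / p + β / n))) ^ p := by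
  have hn : (0 : ℝ) < n := by exact_mod_cast NeZero.pos n
  obtain ⟨C, hC, hm⟩ := exists_mass_ball_le n h
  refine ⟨(2 ^ |β * p| * C ^ (l / n)) ^ (1 / p), by finiteness, fun g R hR => ?_⟩
  set J := ∫⁻ x in ball (0 : Euc n) R, ‖g x‖ₑ ^ p *
    ENNReal.ofReal (weightPow (powerWeight β) p x) with hJ
  have h1 : ENNReal.ofReal R ^ (β * p) * ∫⁻ x in ann 0 R, ‖g x‖ₑ ^ p ≤ 2 ^ |β * p| * J := by
    refine (rpow_mul_setLIntegral_ann_le 0 hR _ _).trans ?_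
    rw [hJ, setLIntegral_mul_weight]
    gcongr
    exact sdiff_subset
  have hψ : psi (weightPow (powerWeight β) p) l (ball (0 : Euc n) R) ≤
      C ^ (l / n) * ENNReal.ofReal R ^ ((β * p + n) * (l / n)) := by
    rw [psi, ENNReal.rpow_mul, ← ENNReal.mul_rpow_of_nonneg _ _ (by positivity)]
    gcongr
    exact hm R hR
  have h2 : J ≤ normKS p l β g ^ p * psi (weightPow (powerWeight β) p) l (ball (0 : Euc n) R) := by
    have h3 : (J / psi (weightPow (powerWeight β) p) l (ball (0 : Euc n) R)) ^ (1 / p) ≤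
        normKS p l β g := by
      unfold normKS normLM
      exact le_iSup₂_of_le R hR le_rfl
    rw [one_div, ENNReal.rpow_inv_le_iff hp] at h3
    have hψ0 : psi (weightPow (powerWeight β) p) l (ball (0 : Euc n) R) ≠ 0 := by
      obtain ⟨C', hC', hm'⟩ := exists_le_mass_ball n β p
      have := hm' R hR
      rw [psi]
      intro h0
      rw [ENNReal.rpow_eq_zero_iff_of_pos (by positivity)] at h0
      rw [h0, mul_zero] at this
      exact ofReal_rpow_ne_zero hR _ (le_antisymm this zero_le)
    have hψ1 : psi (weightPow (powerWeight β) p) l (ball (0 : Euc n) R) ≠ ⊤ := by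
      refine ne_top_of_le_ne_top ?_ hψ
      have := ofReal_rpow_ne_top hR ((β * p + n) * (l / n))
      finiteness
    rwa [ENNReal.div_le_iff hψ0 hψ1] at h3
  -- The exponents match because -βp + (βp+n)l/n = p(n/p - (n-l)(1/p+β/n)).
  calc ∫⁻ x in ann 0 R, ‖g x‖ₑ ^ p
      = ENNReal.ofReal R ^ (-(β * p)) *
          (ENNReal.ofReal R ^ (β * p) * ∫⁻ x in ann 0 R, ‖g x‖ₑ ^ p) := by
        rw [← mul_assoc, ofReal_rpow_mul hR]; simp
    _ ≤ ENNReal.ofReal R ^ (-(β * p)) * (2 ^ |β * p| * (normKS p l β g ^ p *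
          (C ^ (l / n) * ENNReal.ofReal R ^ ((β * p + n) * (l / n))))) := by
        grw [h1, h2, hψ]
    _ = 2 ^ |β * p| * C ^ (l / n) * normKS p l β g ^ p *
          (ENNReal.ofReal R ^ (-(β * p)) * ENNReal.ofReal R ^ ((β * p + n) * (l / n))) := by ring
    _ = _ := by
        rw [ofReal_rpow_mul hR, ENNReal.mul_rpow_of_nonneg _ _ hp.le,
          ENNReal.mul_rpow_of_nonneg _ _ hp.le, rpow_one_div_rpow _ hp.ne', ← ENNReal.rpow_mul]
        congr 2
        field_simp
        ring

/-- Functions with controlled `L^p` norm on annuli are in the Morrey space. -/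
theorem exists_normKS_le_of_ann (n : ℕ) [NeZero n] {p l β : ℝ} (hp : 0 < p) (hl : 0 < l)
    (h : 0 < β * p + n) :
    ∃ C : ℝ≥0∞, C ≠ ⊤ ∧ ∀ {ε : Type*} [ENorm ε] (g : Euc n → ε) (K : ℝ≥0∞),
      (∀ R : ℝ, 0 < R → ∫⁻ x in ann 0 R, ‖g x‖ₑ ^ p ≤ (K *
        ENNReal.ofReal R ^ (n / p - (n - l) * (1 / p + β / n))) ^ p) →
      normKS p l β g ≤ C * K := by
  have hn : (0 : ℝ) < n := by exact_mod_cast NeZero.pos n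
  obtain ⟨C, hC, hm⟩ := exists_le_mass_ball n β p
  -- Once the weight is included the annuli contribute R^((βp+n)l/n); positivity of this exponent is
  -- what sums them to a ball.
  have hs : 0 < (β * p + n) * (l / n) := by positivity
  have hexp : β * p + (n / p - (n - l) * (1 / p + β / n)) * p = (β * p + n) * (l / n) := by
    field_simp
    ring
  refine ⟨((1 - (2 : ℝ≥0∞) ^ (-((β * p + n) * (l / n))))⁻¹ * 2 ^ |β * p| * C ^ (l / n)) ^ (1 / p),
    ?_, fun g K hK => ?_⟩
  · have := geometric_ne_top hs
    finiteness
  refine iSup₂_le fun r hr => ?_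
  refine (ENNReal.rpow_le_rpow_iff hp).1 ?_
  rw [rpow_one_div_rpow _ hp.ne']
  refine ENNReal.div_le_of_le_mul ?_
  rw [setLIntegral_mul_weight]
  have h1 := setLIntegral_rpow_mul_ball_le (0 : Euc n) (a := β * p)
    (b := (n / p - (n - l) * (1 / p + β / n)) * p) (K := K ^ p) (F := fun x => ‖g x‖ₑ ^ p)
    (fun r hr => by
      refine (hK r hr).trans (le_of_eq ?_)
      rw [ENNReal.mul_rpow_of_nonneg _ _ hp.le, ENNReal.rpow_mul]) hr
  rw [hexp] at h1
  refine h1.trans ?_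
  have hψ : ENNReal.ofReal r ^ ((β * p + n) * (l / n)) ≤
      C ^ (l / n) * psi (weightPow (powerWeight β) p) l (ball (0 : Euc n) r) := by
    rw [psi, ENNReal.rpow_mul, ← ENNReal.mul_rpow_of_nonneg _ _ (by positivity)]
    gcongr
    exact hm r hr
  grw [hψ]
  rw [ENNReal.mul_rpow_of_nonneg _ _ hp.le, rpow_one_div_rpow _ hp.ne']
  exact le_of_eq (by ring)

theorem normKS_mono {p l β : ℝ} (hp : 0 ≤ p) {g : Euc n → ε} {h : Euc n → ε'}
    (hgh : ∀ x, ‖g x‖ₑ ≤ ‖h x‖ₑ) : normKS p l β g ≤ normKS p l β h := by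
  unfold normKS normLM
  gcongr with r hr x
  exact hgh x

theorem normKS_congr_ae {p l β : ℝ} {g : Euc n → ε} {h : Euc n → ε'}
    (hgh : ∀ᵐ x, ‖g x‖ₑ = ‖h x‖ₑ) : normKS p l β g = normKS p l β h := by
  unfold normKS normLM
  congr 1; ext r; congr 1; ext hr
  congr 2
  refine lintegral_congr_ae (ae_restrict_of_ae ?_)
  filter_upwards [hgh] with x hx
  rw [hx]

theorem normWKS_mono {p l β : ℝ} (hp : 0 ≤ p) {g : Euc n → ε} {h : Euc n → ε'}
    (hgh : ∀ᵐ x, ‖g x‖ₑ ≤ ‖h x‖ₑ) : normWKS p l β g ≤ normWKS p l β h := by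
  unfold normWKS normWLM
  gcongr with r hr t ht
  unfold mass
  refine lintegral_mono' (Measure.restrict_mono_ae ?_) le_rfl
  filter_upwards [hgh] with x hx
  rintro ⟨h1, h2⟩
  exact ⟨h1, h2.trans_le hx⟩

/-- The truncation `t 1_{|g| > t}`. -/
noncomputable def levelFun (g : Euc n → ε) (t : ℝ≥0∞) : Euc n → ℝ≥0∞ :=
  {x | t < ‖g x‖ₑ}.indicator fun _ => t

theorem levelFun_le (g : Euc n → ε) (t : ℝ≥0∞) (x : Euc n) : levelFun g t x ≤ ‖g x‖ₑ := by
  unfold levelFun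
  by_cases h : t < ‖g x‖ₑ
  · simp [indicator, h, h.le]
  · simp [indicator, h]

/-- The weak quasi-norm is the supremum over t of the strong norms of the truncations t·1_{|g|>t}.
Annular estimates for the strong norm thereby transfer to the weak one. -/
theorem normLM_levelFun_term {p : ℝ} (hp : 0 < p) {w : Euc n → ℝ}
    {g : Euc n → ε} (hg : AEMeasurable (fun x => ‖g x‖ₑ) volume) (t : ℝ≥0) (r : ℝ) (c : ℝ≥0∞) :
    ((∫⁻ x in ball (0 : Euc n) r, ‖levelFun g t x‖ₑ ^ p * ENNReal.ofReal (w x)) / c) ^ (1 / p) =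
    (t : ℝ≥0∞) * (mass w {x ∈ ball (0 : Euc n) r | (t : ℝ≥0∞) < ‖g x‖ₑ}) ^ (1 / p) /
      c ^ (1 / p) := by
  have hS : NullMeasurableSet {x | (t : ℝ≥0∞) < ‖g x‖ₑ} (volume.restrict (ball (0 : Euc n) r)) :=
    nullMeasurableSet_lt aemeasurable_const hg.restrict
  have h1 : ∀ x, ‖levelFun g t x‖ₑ ^ p * ENNReal.ofReal (w x) =
      (t : ℝ≥0∞) ^ p * {x | (t : ℝ≥0∞) < ‖g x‖ₑ}.indicator (fun x => ENNReal.ofReal (w x)) x := by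
    intro x
    by_cases h : (t : ℝ≥0∞) < ‖g x‖ₑ <;> simp [levelFun, indicator, h, hp]
  simp_rw [h1]
  rw [lintegral_const_mul' _ _ (by finiteness), lintegral_indicator₀ hS,
    Measure.restrict_restrict₀ hS, ENNReal.div_rpow_of_nonneg _ _ (by positivity),
    ENNReal.mul_rpow_of_nonneg _ _ (by positivity), ← ENNReal.rpow_mul, mul_one_div_cancel hp.ne',
    ENNReal.rpow_one, mass, inter_comm]
  rfl

theorem normKS_levelFun_le {p l β : ℝ} (hp : 0 < p) {g : Euc n → ε}
    (hg : AEMeasurable (fun x => ‖g x‖ₑ) volume) {t : ℝ≥0} (ht : 0 < t) :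
    normKS p l β (levelFun g t) ≤ normWKS p l β g := by
  refine iSup₂_le fun r hr => ?_
  rw [normLM_levelFun_term hp hg]
  exact le_iSup₂_of_le r hr (le_iSup₂_of_le t ht le_rfl)

theorem normWKS_le_of_levelFun {p l β : ℝ} (hp : 0 < p) {g : Euc n → ε}
    (hg : AEMeasurable (fun x => ‖g x‖ₑ) volume) {K : ℝ≥0∞}
    (h : ∀ t : ℝ≥0, 0 < t → normKS p l β (levelFun g t) ≤ K) : normWKS p l β g ≤ K := by
  refine iSup₂_le fun r hr => iSup₂_le fun t ht => ?_
  rw [← normLM_levelFun_term hp hg]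
  exact le_trans (le_iSup₂_of_le r hr le_rfl) (h t ht)

theorem normWKS_le_normKS {p l β : ℝ} (hp : 0 < p) {g : Euc n → ε}
    (hg : AEMeasurable (fun x => ‖g x‖ₑ) volume) : normWKS p l β g ≤ normKS p l β g :=
  normWKS_le_of_levelFun hp hg fun t _ => normKS_mono hp.le fun x => levelFun_le g t x

theorem exists_ann_le_normWKS (n : ℕ) [NeZero n] {p l β : ℝ} (hp : 0 < p) (hl : 0 < l)
    (h : 0 < β * p + n) :
    ∃ C : ℝ≥0∞, C ≠ ⊤ ∧ ∀ (g : Euc n → ℝ≥0∞), Measurable g → ∀ (R : ℝ), 0 < R →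
      ∀ t : ℝ≥0, 0 < t → t * volume (ann 0 R ∩ {x | (t : ℝ≥0∞) < g x}) ^ (1 / p) ≤
        C * normWKS p l β g * ENNReal.ofReal R ^ (n / p - (n - l) * (1 / p + β / n)) := by
  obtain ⟨C, hC, hann⟩ := exists_ann_le_normKS n hp hl h
  refine ⟨C, hC, fun g hg R hR t ht => ?_⟩
  have h1 := hann (levelFun g t) R hR
  grw [normKS_levelFun_le hp (by simpa using hg.aemeasurable) ht] at h1
  have hS : MeasurableSet {x | (t : ℝ≥0∞) < g x} := measurableSet_lt measurable_const hg
  have h2 : ∀ x, ‖levelFun g t x‖ₑ ^ p =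
      {x | (t : ℝ≥0∞) < g x}.indicator (fun _ => (t : ℝ≥0∞) ^ p) x := by
    intro x
    by_cases h : (t : ℝ≥0∞) < g x <;> simp [levelFun, indicator, h, hp]
  simp_rw [h2] at h1
  rw [lintegral_indicator_const hS, Measure.restrict_apply hS, inter_comm,
    ← ENNReal.rpow_inv_le_iff hp, ENNReal.mul_rpow_of_nonneg _ _ (by positivity),
    ← ENNReal.rpow_mul, mul_inv_cancel₀ hp.ne', ENNReal.rpow_one] at h1
  simpa only [one_div] using h1

theorem eq_zero_of_forall_coe_mul_le {x B : ℝ≥0∞} (hB : B ≠ ⊤)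
    (h : ∀ t : ℝ≥0, 0 < t → (t : ℝ≥0∞) * x ≤ B) : x = 0 := by
  by_contra hx
  have h1 : (⊤ : ℝ≥0∞) ≤ B / x := by
    refine ENNReal.le_of_forall_nnreal_lt fun t _ => ?_
    rw [ENNReal.le_div_iff_mul_le (Or.inl hx) (Or.inr hB)]
    rcases eq_or_lt_of_le (zero_le : 0 ≤ t) with rfl | ht
    · simp
    · exact h t ht
  exact ENNReal.div_ne_top hB hx (top_le_iff.1 h1)

theorem measure_eq_zero_of_ann [NeZero n] {S : Set (Euc n)}
    (h : ∀ R : ℝ, 0 < R → volume (ann 0 R ∩ S) = 0) : volume S = 0 := by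
  have h1 : S ⊆ {0} ∪ ((⋃ k : ℕ, ann 0 (1 * (1 / 2) ^ k) ∩ S) ∪
      ⋃ k : ℕ, ann 0 (2 * 1 * 2 ^ k) ∩ S) := by
    intro x hx
    by_cases hb : x ∈ ball (0 : Euc n) 1
    · rcases ball_subset_iUnion_ann 0 one_pos hb with h0 | h0
      · exact Or.inl h0
      · rw [← iUnion_inter]
        exact Or.inr (Or.inl ⟨h0, hx⟩)
    · rw [← iUnion_inter, ← iUnion_inter]
      exact Or.inr (Or.inr ⟨compl_ball_subset_iUnion_ann 0 one_pos hb, hx⟩)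
  refine measure_mono_null h1 (measure_union_null (measure_singleton _)
    (measure_union_null (measure_iUnion_null fun k => h _ (by positivity))
      (measure_iUnion_null fun k => h _ (by positivity))))

/-- On an annulus the set where g = `⊤` lies in every {g > t}, so t times a power of its measure
stays bounded as t grows. This yields almost everywhere convergence of potentials, and in the
converse a point where the test function has a finite image. -/
theorem ae_lt_top_of_normWKS [NeZero n] {p l β : ℝ} (hp : 0 < p) (hl : 0 < l)
    (h : 0 < β * p + n) {g : Euc n → ℝ≥0∞} (hg : Measurable g) (hN : normWKS p l β g ≠ ⊤) :
    ∀ᵐ x, g x < ⊤ := by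
  obtain ⟨C, hC, hann⟩ := exists_ann_le_normWKS n hp hl h
  rw [ae_iff]
  refine measure_eq_zero_of_ann fun R hR => ?_
  have h1 : volume (ann 0 R ∩ {x | ¬ g x < ⊤}) ^ (1 / p) = 0 := by
    refine eq_zero_of_forall_coe_mul_le
      (ENNReal.mul_ne_top (ENNReal.mul_ne_top hC hN) (ofReal_rpow_ne_top hR _))
      fun t ht => le_trans ?_ (hann g hg R hR t ht)
    gcongr with x
    intro hx
    rw [not_lt, top_le_iff] at hx
    rw [hx]; exact ENNReal.coe_lt_top
  rwa [ENNReal.rpow_eq_zero_iff_of_pos (by positivity)] at h1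

end LocalMorrey

/-! ### Pointwise bounds on an annulus -/

namespace LocalMorrey

open Metric Set

variable {n : ℕ}

/-- The fractional integral of a nonnegative function. -/
noncomputable def potential (α : ℝ) (F : Euc n → ℝ≥0∞) (x : Euc n) : ℝ≥0∞ :=
  ∫⁻ y, ‖x - y‖ₑ ^ (α - n) * F y

/-- The fractional maximal function of a nonnegative function. -/
noncomputable def maximalPotential (α : ℝ) (F : Euc n → ℝ≥0∞) (x : Euc n) : ℝ≥0∞ :=
  ⨆ (c : Euc n) (r : ℝ) (_ : x ∈ ball c r),
    (∫⁻ y in ball c r, F y) / volume (ball c r) ^ (1 - α / n)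

theorem measurable_maximalPotential (α : ℝ) (F : Euc n → ℝ≥0∞) :
    Measurable (maximalPotential α F) :=
  measurable_iSup_ball _

theorem volume_ball_rpow [NeZero n] {α : ℝ} (hαn : α < n) (c : Euc n) {r : ℝ} (hr : 0 < r) :
    volume (ball c r) ^ (1 - α / n) =
      ENNReal.ofReal r ^ (n - α) * volume (ball (0 : Euc n) 1) ^ (1 - α / n) := by
  have hn : (0 : ℝ) < n := by exact_mod_cast NeZero.pos n
  rw [volume_ball_eq c hr, ENNReal.mul_rpow_of_nonneg _ _
    (by rw [sub_nonneg, div_le_one hn]; exact hαn.le), ← ENNReal.rpow_mul]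
  congr 2
  field_simp

/-- Two points of a ball of radius r are less than 2r apart, so the kernel is at least (2r)^(α-n).
Keeping the right side on the same ball lets small balls be compared with the ring part only. -/
theorem exists_ball_average_le (n : ℕ) [NeZero n] {α : ℝ} (hαn : α < n) :
    ∃ C : ℝ≥0∞, C ≠ ⊤ ∧ ∀ (F : Euc n → ℝ≥0∞) (x c : Euc n) (r : ℝ), x ∈ ball c r →
      (∫⁻ y in ball c r, F y) / volume (ball c r) ^ (1 - α / n) ≤
        C * ∫⁻ y in ball c r, ‖x - y‖ₑ ^ (α - n) * F y := by
  have hv : volume (ball (0 : Euc n) 1) ^ (1 - α / n) ≠ 0 := by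
    simp [ENNReal.rpow_eq_zero_iff, volume_unitBall_ne_zero, volume_unitBall_ne_top]
  have hv' : volume (ball (0 : Euc n) 1) ^ (1 - α / n) ≠ ⊤ :=
    ENNReal.rpow_ne_top_of_ne_zero volume_unitBall_ne_zero volume_unitBall_ne_top
  have hα : 0 ≤ n - α := by linarith
  refine ⟨2 ^ (n - α) * (volume (ball (0 : Euc n) 1) ^ (1 - α / n))⁻¹, by finiteness,
    fun F x c r hx => ?_⟩
  have hr : 0 < r := pos_of_mem_ball hx
  refine ENNReal.div_le_of_le_mul ?_
  calc ∫⁻ y in ball c r, F y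
      ≤ ∫⁻ y in ball c r, ENNReal.ofReal (2 * r) ^ (n - α) * (‖x - y‖ₑ ^ (α - n) * F y) := by
        refine setLIntegral_mono' measurableSet_ball fun y hy => ?_
        have h1 : ENNReal.ofReal (2 * r) ^ (α - n) ≤ ‖x - y‖ₑ ^ (α - n) := by
          refine rpow_le_rpow_of_nonpos (by linarith) ?_
          rw [enorm_sub_eq_ofReal_dist]
          refine ENNReal.ofReal_le_ofReal ?_
          have := dist_triangle_right y x c
          rw [mem_ball] at hx hy
          linarith
        calc F y = ENNReal.ofReal (2 * r) ^ (n - α) * (ENNReal.ofReal (2 * r) ^ (α - n) * F y) := by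
              rw [← mul_assoc, ofReal_rpow_mul (by positivity)]; simp
          _ ≤ _ := by gcongr
    _ = ENNReal.ofReal (2 * r) ^ (n - α) * ∫⁻ y in ball c r, ‖x - y‖ₑ ^ (α - n) * F y :=
        lintegral_const_mul' _ _ (ofReal_rpow_ne_top (by positivity) _)
    _ = 2 ^ (n - α) * (∫⁻ y in ball c r, ‖x - y‖ₑ ^ (α - n) * F y) * ENNReal.ofReal r ^ (n - α) *
          ((volume (ball (0 : Euc n) 1) ^ (1 - α / n))⁻¹ *
            volume (ball (0 : Euc n) 1) ^ (1 - α / n)) := by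
        rw [ENNReal.inv_mul_cancel hv hv', ofReal_mul_rpow two_pos]
        simp only [ENNReal.ofReal_ofNat]
        ring
    _ = _ := by rw [volume_ball_rpow hαn c hr]; ring

theorem exists_maximalPotential_le_potential (n : ℕ) [NeZero n] {α : ℝ} (hαn : α < n) :
    ∃ C : ℝ≥0∞, C ≠ ⊤ ∧ ∀ (F : Euc n → ℝ≥0∞) (x : Euc n),
      maximalPotential α F x ≤ C * potential α F x := by
  obtain ⟨C, hC, h⟩ := exists_ball_average_le n hαn
  refine ⟨C, hC, fun F x => iSup_le fun c => iSup_le fun r => iSup_le fun hx => ?_⟩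
  refine (h F x c r hx).trans ?_
  gcongr
  exact setLIntegral_le_lintegral _ _

theorem setLIntegral_ann_le_of_rpow [NeZero n] {p A : ℝ} (hp : 1 ≤ p) {F : Euc n → ℝ≥0∞}
    (hF : Measurable F) {K : ℝ≥0∞}
    (hK : ∀ R : ℝ, 0 < R → ∫⁻ x in ann 0 R, F x ^ p ≤ (K * ENNReal.ofReal R ^ (n / p - A)) ^ p)
    (R : ℝ) (hR : 0 < R) :
    ∫⁻ x in ann 0 R, F x ≤
      volume (ball (0 : Euc n) 1) ^ (1 - 1 / p) * K * ENNReal.ofReal R ^ (n - A) := by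
  have hp0 : 0 < p := by linarith
  have h1 : 0 ≤ 1 - 1 / p := by rw [sub_nonneg, div_le_one hp0]; exact hp
  grw [setLIntegral_le_rpow_mul_measure hp _ hF, hK R hR, volume_ann_le 0 hR]
  rw [ENNReal.mul_rpow_of_nonneg _ _ h1, ← ENNReal.rpow_mul, ← ENNReal.rpow_mul,
    mul_one_div_cancel hp0.ne', ENNReal.rpow_one,
    show (n : ℝ) - A = n / p - A + n * (1 - 1 / p) by ring, ← ofReal_rpow_mul hR]
  exact le_of_eq (by ring)

/-- The part of a function that is close to the annulus of radius `R`. -/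
noncomputable def middle (F : Euc n → ℝ≥0∞) (R : ℝ) : Euc n → ℝ≥0∞ :=
  (ball 0 (2 * R) \ ball 0 (R / 4)).indicator F

theorem measurableSet_middle (R : ℝ) :
    MeasurableSet (ball (0 : Euc n) (2 * R) \ ball 0 (R / 4)) :=
  measurableSet_ball.diff measurableSet_ball

/-- The ring R/4 ≤ |y| < 2R is covered by the annuli of outer radii 2R, R and R/2. -/
theorem exists_lintegral_middle_rpow_le (n : ℕ) {p A : ℝ} (hp : 0 < p) :
    ∃ C : ℝ≥0∞, C ≠ ⊤ ∧ ∀ (F : Euc n → ℝ≥0∞) (K : ℝ≥0∞),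
      (∀ R : ℝ, 0 < R → ∫⁻ x in ann 0 R, F x ^ p ≤ (K * ENNReal.ofReal R ^ (n / p - A)) ^ p) →
      ∀ R : ℝ, 0 < R →
        ∫⁻ x, middle F R x ^ p ≤ (C * (K * ENNReal.ofReal R ^ (n / p - A))) ^ p := by
  set b := n / p - A
  have h2 : (0 : ℝ) < 1 / 2 := by norm_num
  refine ⟨((ENNReal.ofReal 2 ^ b) ^ p + 1 + (ENNReal.ofReal (1 / 2) ^ b) ^ p) ^ (1 / p), ?_,
    fun F K hK R hR => ?_⟩
  · have h3 := ofReal_rpow_ne_top two_pos b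
    have h4 := ofReal_rpow_ne_top h2 b
    finiteness
  have hsub : ball (0 : Euc n) (2 * R) \ ball 0 (R / 4) ⊆
      ann 0 (2 * R) ∪ (ann 0 R ∪ ann 0 (1 / 2 * R)) := by
    intro y hy
    simp only [mem_sdiff, mem_ball, mem_union, mem_ann] at hy ⊢
    by_cases h1 : R ≤ dist y 0
    · left; constructor <;> linarith [hy.1]
    by_cases h2 : R / 2 ≤ dist y 0
    · right; left; constructor <;> linarith
    · right; right; constructor <;> linarith [hy.2]
  have h1 : ∫⁻ x, middle F R x ^ p =
      ∫⁻ x in ball (0 : Euc n) (2 * R) \ ball 0 (R / 4), F x ^ p := by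
    rw [← lintegral_indicator (measurableSet_middle R)]
    congr 1
    ext x
    by_cases hx : x ∈ ball (0 : Euc n) (2 * R) \ ball 0 (R / 4)
    · simp only [middle, indicator_of_mem hx]
    · simp only [middle, indicator_of_notMem hx, ENNReal.zero_rpow_of_pos hp]
  rw [h1]
  calc _ ≤ ∫⁻ x in ann 0 (2 * R) ∪ (ann 0 R ∪ ann 0 (1 / 2 * R)), F x ^ p :=
        lintegral_mono_set hsub
    _ ≤ (∫⁻ x in ann 0 (2 * R), F x ^ p) +
          ((∫⁻ x in ann 0 R, F x ^ p) + ∫⁻ x in ann 0 (1 / 2 * R), F x ^ p) :=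
        (lintegral_union_le _ _ _).trans (by gcongr; exact lintegral_union_le _ _ _)
    _ ≤ (K * ENNReal.ofReal (2 * R) ^ b) ^ p + ((K * ENNReal.ofReal R ^ b) ^ p +
          (K * ENNReal.ofReal (1 / 2 * R) ^ b) ^ p) := by
        gcongr <;> exact hK _ (by positivity)
    _ = _ := by
        rw [ENNReal.mul_rpow_of_nonneg (_ ^ (1 / p)) _ hp.le, rpow_one_div_rpow _ hp.ne',
          ofReal_mul_rpow two_pos, ofReal_mul_rpow h2]
        simp only [ENNReal.mul_rpow_of_nonneg _ _ hp.le]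
        ring

theorem setLIntegral_mul_middle_le {F : Euc n → ℝ≥0∞} {S S' : Set (Euc n)} {R : ℝ}
    (hS : MeasurableSet S) (hSR : S ⊆ ball 0 (2 * R) \ ball 0 (R / 4)) (hSS : S ⊆ S')
    (k : Euc n → ℝ≥0∞) : ∫⁻ y in S, k y * F y ≤ ∫⁻ y in S', k y * middle F R y := by
  refine le_trans (le_of_eq (setLIntegral_congr_fun hS fun y hy => ?_)) (lintegral_mono_set hSS)
  simp only [middle, indicator_of_mem (hSR hy)]

/-- Split at |y| = R/4 and |y| = 2R. Points y of the ring satisfy |x-y| < R + 2R, whence the ball of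
radius 3R. -/
theorem exists_potential_le_on_ann (n : ℕ) [NeZero n] {α p A : ℝ} (hp : 1 ≤ p)
    (hαA : α < A) (hAn : A < n) :
    ∃ C : ℝ≥0∞, C ≠ ⊤ ∧ ∀ F : Euc n → ℝ≥0∞, Measurable F → ∀ K : ℝ≥0∞,
      (∀ R : ℝ, 0 < R → ∫⁻ x in ann 0 R, F x ^ p ≤ (K * ENNReal.ofReal R ^ (n / p - A)) ^ p) →
      ∀ (R : ℝ) (x : Euc n), x ∈ ann 0 R →
        potential α F x ≤ (∫⁻ y in ball x (3 * R), ‖x - y‖ₑ ^ (α - n) * middle F R y) +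
          C * K * ENNReal.ofReal R ^ (α - A) := by
  have hp0 : 0 < p := by linarith
  have h1p : 0 ≤ 1 - 1 / p := by rw [sub_nonneg, div_le_one hp0]; exact hp
  have h4 : (0 : ℝ) < 1 / 4 := by norm_num
  have h2 : (0 : ℝ) < 1 / 2 := by norm_num
  set v := volume (ball (0 : Euc n) 1)
  have hv : v ≠ ⊤ := volume_unitBall_ne_top
  refine ⟨ENNReal.ofReal (1 / 4) ^ (α - n) * ((1 - (2 : ℝ≥0∞) ^ (-(n - A)))⁻¹ *
      (v ^ (1 - 1 / p) * ENNReal.ofReal (1 / 4) ^ (n - A))) +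
    ENNReal.ofReal (1 / 2) ^ (α - n) * ((1 - (2 : ℝ≥0∞) ^ (α - A))⁻¹ *
      (2 ^ |α - n| * v ^ (1 - 1 / p) * ENNReal.ofReal 2 ^ (α - A))), ?_,
    fun F hF K hK R x hx => ?_⟩
  · have e1 := ofReal_rpow_ne_top h4 (α - n)
    have e2 := ofReal_rpow_ne_top h4 (n - A)
    have e3 := ofReal_rpow_ne_top h2 (α - n)
    have e4 := ofReal_rpow_ne_top two_pos (α - A)
    have e5 := geometric_ne_top (sub_pos.2 hAn)
    have e6 : (1 - (2 : ℝ≥0∞) ^ (α - A))⁻¹ ≠ ⊤ := by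
      have := geometric_ne_top (sub_pos.2 hαA)
      simpa using this
    finiteness
  rw [mem_ann] at hx
  have hR : 0 < R := by linarith
  have hann := setLIntegral_ann_le_of_rpow hp hF hK
  have hcov : (univ : Set (Euc n)) ⊆ (ball 0 (2 * R) \ ball 0 (R / 4)) ∪
      (ball 0 (1 / 4 * R) ∪ (ball 0 (2 * R))ᶜ) := by
    intro y _
    simp only [mem_union, mem_sdiff, mem_ball, mem_compl_iff]
    by_cases hy1 : dist y 0 < 2 * R
    · by_cases hy2 : dist y 0 < R / 4
      · right; left; linarith
      · left; exact ⟨hy1, hy2⟩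
    · right; right; exact hy1
  -- Here |x| ≥ R/2 and |y| < R/4 give |x-y| ≥ R/4. The finite constant rests on A < n.
  have hin : ∫⁻ y in ball 0 (1 / 4 * R), ‖x - y‖ₑ ^ (α - n) * F y ≤
      ENNReal.ofReal (1 / 4) ^ (α - n) * ((1 - (2 : ℝ≥0∞) ^ (-(n - A)))⁻¹ *
      (v ^ (1 - 1 / p) * ENNReal.ofReal (1 / 4) ^ (n - A))) * K * ENNReal.ofReal R ^ (α - A) := by
    calc _ ≤ ∫⁻ y in ball 0 (1 / 4 * R), ENNReal.ofReal (1 / 4 * R) ^ (α - n) * F y := by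
          refine setLIntegral_mono' measurableSet_ball fun y hy => ?_
          gcongr ?_ * _
          refine rpow_le_rpow_of_nonpos (by linarith) ?_
          rw [enorm_sub_eq_ofReal_dist]
          refine ENNReal.ofReal_le_ofReal ?_
          have := dist_triangle x y 0
          rw [mem_ball] at hy
          rw [dist_comm y x]
          linarith
      _ = ENNReal.ofReal (1 / 4 * R) ^ (α - n) * ∫⁻ y in ball 0 (1 / 4 * R), F y :=
          lintegral_const_mul' _ _ (ofReal_rpow_ne_top (by positivity) _)
      _ ≤ ENNReal.ofReal (1 / 4 * R) ^ (α - n) * ((1 - (2 : ℝ≥0∞) ^ (-(n - A)))⁻¹ *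
            (v ^ (1 - 1 / p) * K * ENNReal.ofReal (1 / 4 * R) ^ (n - A))) := by
          gcongr
          exact setLIntegral_ball_le_of_ann 0 hann (by positivity)
      _ = _ := by
          rw [ofReal_mul_rpow h4, ofReal_mul_rpow h4, show α - A = α - n + (n - A) by ring,
            ← ofReal_rpow_mul hR]
          ring
  -- Here |y| ≥ 2R > 2|x| gives |x-y| ≥ |y|/2. The sum over growing annuli needs α < A.
  have hout : ∫⁻ y in (ball 0 (2 * R))ᶜ, ‖x - y‖ₑ ^ (α - n) * F y ≤
      ENNReal.ofReal (1 / 2) ^ (α - n) * ((1 - (2 : ℝ≥0∞) ^ (α - A))⁻¹ *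
      (2 ^ |α - n| * v ^ (1 - 1 / p) * ENNReal.ofReal 2 ^ (α - A))) * K *
        ENNReal.ofReal R ^ (α - A) := by
    have hexp : α - n + (n - A) = α - A := by ring
    calc _ ≤ ∫⁻ y in (ball 0 (2 * R))ᶜ,
          ENNReal.ofReal (1 / 2) ^ (α - n) * (‖0 - y‖ₑ ^ (α - n) * F y) := by
          refine setLIntegral_mono' measurableSet_ball.compl fun y hy => ?_
          have hy : 2 * R ≤ dist y 0 := by simpa using hy
          rw [← mul_assoc]
          gcongr ?_ * _
          rw [enorm_sub_eq_ofReal_dist, enorm_sub_eq_ofReal_dist, ← ofReal_mul_rpow h2]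
          refine rpow_le_rpow_of_nonpos (by linarith) ?_
          refine ENNReal.ofReal_le_ofReal ?_
          have := dist_triangle y x 0
          linarith
      _ = ENNReal.ofReal (1 / 2) ^ (α - n) *
            ∫⁻ y in (ball 0 (2 * R))ᶜ, ‖0 - y‖ₑ ^ (α - n) * F y :=
          lintegral_const_mul' _ _ (ofReal_rpow_ne_top h2 _)
      _ ≤ ENNReal.ofReal (1 / 2) ^ (α - n) * ((1 - (2 : ℝ≥0∞) ^ (α - n + (n - A)))⁻¹ *
            (2 ^ |α - n| * (v ^ (1 - 1 / p) * K) *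
              ENNReal.ofReal (2 * R) ^ (α - n + (n - A)))) := by
          gcongr
          exact setLIntegral_rpow_mul_compl_ball_le 0 (by linarith) hann (by positivity)
      _ = _ := by
          rw [hexp, ofReal_mul_rpow two_pos]
          ring
  calc potential α F x = ∫⁻ y in univ, ‖x - y‖ₑ ^ (α - n) * F y := by
        rw [setLIntegral_univ, potential]
    _ ≤ (∫⁻ y in ball 0 (2 * R) \ ball 0 (R / 4), ‖x - y‖ₑ ^ (α - n) * F y) +
          ((∫⁻ y in ball 0 (1 / 4 * R), ‖x - y‖ₑ ^ (α - n) * F y) +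
            ∫⁻ y in (ball 0 (2 * R))ᶜ, ‖x - y‖ₑ ^ (α - n) * F y) :=
        (lintegral_mono_set hcov).trans ((lintegral_union_le _ _ _).trans
          (by gcongr; exact lintegral_union_le _ _ _))
    _ ≤ _ := by
        rw [add_mul, add_mul]
        refine add_le_add (setLIntegral_mul_middle_le (measurableSet_middle R) subset_rfl
          (fun y hy => ?_) _) (add_le_add hin hout)
        have h3 := dist_triangle_right y x 0
        have h4 := mem_ball.1 hy.1
        rw [mem_ball]
        linarith

/-- No sum over large scales appears: a large ball is estimated by itself, so α ≤ A suffices. -/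
theorem exists_maximalPotential_le_on_ann (n : ℕ) [NeZero n] {α p A : ℝ} (hαn : α < n)
    (hp : 1 ≤ p) (hαA : α ≤ A) (hAn : A < n) :
    ∃ C : ℝ≥0∞, C ≠ ⊤ ∧ ∀ F : Euc n → ℝ≥0∞, Measurable F → ∀ K : ℝ≥0∞,
      (∀ R : ℝ, 0 < R → ∫⁻ x in ann 0 R, F x ^ p ≤ (K * ENNReal.ofReal R ^ (n / p - A)) ^ p) →
      ∀ (R : ℝ) (x : Euc n), x ∈ ann 0 R →
        maximalPotential α F x ≤
          C * (∫⁻ y in ball x (3 * R), ‖x - y‖ₑ ^ (α - n) * middle F R y) +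
          C * K * ENNReal.ofReal R ^ (α - A) := by
  have hp0 : 0 < p := by linarith
  have h1p : 0 ≤ 1 - 1 / p := by rw [sub_nonneg, div_le_one hp0]; exact hp
  have h8 : (0 : ℝ) < 1 / 8 := by norm_num
  have h10 : (0 : ℝ) < 10 := by norm_num
  set v := volume (ball (0 : Euc n) 1)
  have hv0 : v ≠ 0 := volume_unitBall_ne_zero
  have hv : v ≠ ⊤ := volume_unitBall_ne_top
  have hw0 : v ^ (1 - α / n) ≠ 0 := by simp [ENNReal.rpow_eq_zero_iff, hv0, hv]
  have hw : v ^ (1 - α / n) ≠ ⊤ := ENNReal.rpow_ne_top_of_ne_zero hv0 hv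
  obtain ⟨C, hC, havg⟩ := exists_ball_average_le n hαn
  set D := (1 - (2 : ℝ≥0∞) ^ (-(n - A)))⁻¹ * (v ^ (1 - 1 / p) * ENNReal.ofReal 10 ^ (n - A)) *
      (v ^ (1 - α / n))⁻¹ * ENNReal.ofReal (1 / 8) ^ (α - A) with hD
  have hDt : D ≠ ⊤ := by
    have e1 := ofReal_rpow_ne_top h8 (α - A)
    have e2 := ofReal_rpow_ne_top h10 (n - A)
    have e5 := geometric_ne_top (sub_pos.2 hAn)
    finiteness
  refine ⟨C + D, by finiteness, fun F hF K hK R x hx => ?_⟩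
  rw [mem_ann] at hx
  have hR : 0 < R := by linarith
  have hann := setLIntegral_ann_le_of_rpow hp hF hK
  refine iSup_le fun c => iSup_le fun r => iSup_le fun hxr => ?_
  have hr : 0 < r := pos_of_mem_ball hxr
  -- A ball of radius r < R/8 through x stays in the ring. If r ≥ R/8, then |x| < R ≤ 8r puts the
  -- ball inside the centred ball of radius 10r, and r^(α-A) ≤ (R/8)^(α-A).
  rcases lt_or_ge r (R / 8) with hrR | hrR
  · refine (havg F x c r hxr).trans (le_add_right ?_)
    refine mul_le_mul' le_self_add (setLIntegral_mul_middle_le measurableSet_ball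
      (fun y hy => ?_) (fun y hy => ?_) _)
    · rw [mem_ball] at hy hxr
      have h1 := dist_triangle_right y x c
      have h2 := dist_triangle y x 0
      have h3 := dist_triangle_left x 0 y
      simp only [mem_sdiff, mem_ball]
      constructor <;> linarith
    · rw [mem_ball] at hy hxr ⊢
      have h1 := dist_triangle_right y x c
      linarith
  · refine le_add_left (le_trans ?_ (mul_le_mul_left (mul_le_mul_left le_add_self K) _))
    refine ENNReal.div_le_of_le_mul ?_
    have hsub : ball c r ⊆ ball 0 (10 * r) := by
      intro y hy
      rw [mem_ball] at hy hxr ⊢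
      have h1 := dist_triangle_right y x c
      have h2 := dist_triangle y x 0
      linarith
    have hmono : ENNReal.ofReal r ^ (α - A) ≤ ENNReal.ofReal (1 / 8 * R) ^ (α - A) :=
      rpow_le_rpow_of_nonpos (by linarith) (ENNReal.ofReal_le_ofReal (by linarith))
    calc ∫⁻ y in ball c r, F y ≤ ∫⁻ y in ball 0 (10 * r), F y := lintegral_mono_set hsub
      _ ≤ (1 - (2 : ℝ≥0∞) ^ (-(n - A)))⁻¹ *
            (v ^ (1 - 1 / p) * K * ENNReal.ofReal (10 * r) ^ (n - A)) :=
          setLIntegral_ball_le_of_ann 0 hann (by positivity)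
      _ = (1 - (2 : ℝ≥0∞) ^ (-(n - A)))⁻¹ * (v ^ (1 - 1 / p) * ENNReal.ofReal 10 ^ (n - A)) *
            K * ENNReal.ofReal r ^ (n - α) * ENNReal.ofReal r ^ (α - A) *
              ((v ^ (1 - α / n))⁻¹ * v ^ (1 - α / n)) := by
          rw [ENNReal.inv_mul_cancel hw0 hw, ofReal_mul_rpow h10,
            show n - A = n - α + (α - A) by ring, ← ofReal_rpow_mul hr]
          ring
      _ ≤ (1 - (2 : ℝ≥0∞) ^ (-(n - A)))⁻¹ * (v ^ (1 - 1 / p) * ENNReal.ofReal 10 ^ (n - A)) *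
            K * ENNReal.ofReal r ^ (n - α) * ENNReal.ofReal (1 / 8 * R) ^ (α - A) *
              ((v ^ (1 - α / n))⁻¹ * v ^ (1 - α / n)) := by gcongr
      _ = _ := by
          rw [volume_ball_rpow hαn c hr, ofReal_mul_rpow h8, hD]
          ring

end LocalMorrey

/-! ### From annular bounds to Morrey bounds -/

namespace LocalMorrey

open Metric Set

variable {n : ℕ}

/-- A Morrey bound for functions that are, on each annulus, a sum of a function with controlled
`L^q` norm and a constant. -/
theorem exists_normKS_le_of_local (n : ℕ) [NeZero n] {q l β : ℝ} (hq : 1 ≤ q) (hl : 0 < l)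
    (h : 0 < β * q + n) :
    ∃ C : ℝ≥0∞, C ≠ ⊤ ∧ ∀ (g : Euc n → ℝ≥0∞) (L : ℝ → Euc n → ℝ≥0∞) (K : ℝ≥0∞),
      (∀ (R : ℝ), ∀ x ∈ ann 0 R, g x ≤ L R x +
        K * ENNReal.ofReal R ^ (-((n - l) * (1 / q + β / n)))) →
      (∀ R : ℝ, 0 < R → ∫⁻ x, L R x ^ q ≤
        (K * ENNReal.ofReal R ^ (n / q - (n - l) * (1 / q + β / n))) ^ q) →
      normKS q l β g ≤ C * K := by
  have hq0 : 0 < q := by linarith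
  obtain ⟨C, hC, hann⟩ := exists_normKS_le_of_ann n hq0 hl h
  set A := (n - l) * (1 / q + β / n)
  set v := volume (ball (0 : Euc n) 1)
  have hv : v ≠ ⊤ := volume_unitBall_ne_top
  refine ⟨C * (2 ^ (q - 1) * (1 + v)) ^ (1 / q), by finiteness, fun g L K hg hL => ?_⟩
  rw [mul_assoc]
  refine hann g _ fun R hR => ?_
  calc ∫⁻ x in ann 0 R, ‖g x‖ₑ ^ q
      ≤ ∫⁻ x in ann 0 R, 2 ^ (q - 1) * (L R x ^ q + (K * ENNReal.ofReal R ^ (-A)) ^ q) := by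
        refine setLIntegral_mono' (measurableSet_ann 0 R) fun x hx => ?_
        rw [enorm_eq_self]
        grw [hg R x hx]
        exact ENNReal.rpow_add_le_mul_rpow_add_rpow _ _ hq
    _ = 2 ^ (q - 1) * ((∫⁻ x in ann 0 R, L R x ^ q) +
          (K * ENNReal.ofReal R ^ (-A)) ^ q * volume (ann (0 : Euc n) R)) := by
        rw [lintegral_const_mul' _ _ (by finiteness), lintegral_add_right _ measurable_const,
          setLIntegral_const]
    _ ≤ 2 ^ (q - 1) * ((K * ENNReal.ofReal R ^ (n / q - A)) ^ q +
          (K * ENNReal.ofReal R ^ (-A)) ^ q * (ENNReal.ofReal R ^ (n : ℝ) * v)) := by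
        gcongr
        · exact (setLIntegral_le_lintegral _ _).trans (hL R hR)
        · exact volume_ann_le 0 hR
    _ = 2 ^ (q - 1) * ((K * ENNReal.ofReal R ^ (n / q - A)) ^ q +
          (K * ENNReal.ofReal R ^ (n / q - A)) ^ q * v) := by
        have e : ENNReal.ofReal R ^ (n / q - A) =
            ENNReal.ofReal R ^ (-A) * ENNReal.ofReal R ^ (n / q) := by
          rw [ofReal_rpow_mul hR, neg_add_eq_sub]
        rw [e]
        simp only [ENNReal.mul_rpow_of_nonneg _ _ hq0.le]
        rw [rpow_div_rpow _ _ hq0.ne']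
        ring
    _ = _ := by
        rw [mul_assoc (_ ^ (1 / q)), ENNReal.mul_rpow_of_nonneg (_ ^ (1 / q)) _ hq0.le,
          rpow_one_div_rpow _ hq0.ne']
        ring

/-- If g > t while L ≤ t/2, the constant term is at least t/2. So t·1_{g>t} is at most t·1_{L>t/2}
plus twice the constant, and the strong version applies to it with 2K. -/
theorem exists_normWKS_le_of_local (n : ℕ) [NeZero n] {q l β : ℝ} (hq : 1 ≤ q) (hl : 0 < l)
    (h : 0 < β * q + n) :
    ∃ C : ℝ≥0∞, C ≠ ⊤ ∧ ∀ (g : Euc n → ℝ≥0∞), Measurable g →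
      ∀ (L : ℝ → Euc n → ℝ≥0∞) (K : ℝ≥0∞),
      (∀ (R : ℝ), ∀ x ∈ ann 0 R, g x ≤ L R x +
        K * ENNReal.ofReal R ^ (-((n - l) * (1 / q + β / n)))) →
      (∀ R : ℝ, 0 < R → ∀ t : ℝ≥0∞, t ≠ 0 → t ≠ ⊤ → t ^ q * volume {x | t < L R x} ≤
        (K * ENNReal.ofReal R ^ (n / q - (n - l) * (1 / q + β / n))) ^ q) →
      normWKS q l β g ≤ C * K := by
  have hq0 : 0 < q := by linarith
  obtain ⟨C, hC, hloc⟩ := exists_normKS_le_of_local n hq hl h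
  set A := (n - l) * (1 / q + β / n)
  refine ⟨C * 2, by finiteness, fun g hgm L K hg hL => ?_⟩
  refine normWKS_le_of_levelFun hq0 (by simpa using hgm.aemeasurable) fun t ht => ?_
  rw [mul_assoc]
  refine hloc _ (fun R => {x | (t / 2 : ℝ≥0∞) < L R x}.indicator fun _ => (t : ℝ≥0∞)) _
    (fun R x hx => ?_) fun R hR => ?_
  · by_cases hgx : (t : ℝ≥0∞) < g x
    · rw [levelFun, indicator_of_mem (by simpa using hgx)]
      by_cases hLx : (t / 2 : ℝ≥0∞) < L R x
      · rw [indicator_of_mem (by simpa using hLx)]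
        exact le_self_add
      · refine le_add_left ?_
        by_contra hc
        rw [not_le, mul_assoc, mul_comm, ← ENNReal.lt_div_iff_mul_lt (Or.inl two_ne_zero)
          (Or.inl ENNReal.ofNat_ne_top)] at hc
        have h1 := (hgx.trans_le (hg R x hx)).trans_le
          (add_le_add (not_lt.1 hLx) hc.le)
        rw [ENNReal.add_halves] at h1
        exact lt_irrefl _ h1
    · rw [levelFun, indicator_of_notMem (by simpa using hgx)]
      exact zero_le
  · have ht2 : (t / 2 : ℝ≥0∞) ≠ 0 := by simp [ht.ne']
    have h1 : ∀ x, ({x | (t / 2 : ℝ≥0∞) < L R x}.indicator (fun _ => (t : ℝ≥0∞)) x) ^ q =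
        {x | (t / 2 : ℝ≥0∞) < L R x}.indicator (fun _ => (t : ℝ≥0∞) ^ q) x := by
      intro x
      by_cases hLx : (t / 2 : ℝ≥0∞) < L R x <;> simp [indicator, hLx, hq0]
    simp_rw [h1]
    refine (lintegral_indicator_const_le _ _).trans ?_
    have h2 : (t : ℝ≥0∞) ^ q = 2 ^ q * (t / 2 : ℝ≥0∞) ^ q := by
      rw [← ENNReal.mul_rpow_of_nonneg _ _ hq0.le,
        ENNReal.mul_div_cancel two_ne_zero ENNReal.ofNat_ne_top]
    rw [h2, mul_assoc]
    grw [hL R hR _ ht2 (ENNReal.div_ne_top ENNReal.coe_ne_top two_ne_zero)]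
    rw [← ENNReal.mul_rpow_of_nonneg _ _ hq0.le, mul_assoc]

theorem lintegral_middle_rpow_ne_top {p A : ℝ} (hp : 0 < p) {F : Euc n → ℝ≥0∞} {K : ℝ≥0∞}
    (hK : K ≠ ⊤)
    (h : ∀ R : ℝ, 0 < R → ∫⁻ x in ann 0 R, F x ^ p ≤ (K * ENNReal.ofReal R ^ (n / p - A)) ^ p)
    {R : ℝ} (hR : 0 < R) : ∫⁻ x, middle F R x ^ p ≠ ⊤ := by
  obtain ⟨C, hC, hm⟩ := exists_lintegral_middle_rpow_le n (A := A) hp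
  refine ne_top_of_le_ne_top ?_ (hm F K h R hR)
  have := ofReal_rpow_ne_top hR (n / p - A)
  finiteness

theorem measurable_middle {F : Euc n → ℝ≥0∞} (hF : Measurable F) (R : ℝ) :
    Measurable (middle F R) :=
  hF.indicator (measurableSet_middle R)

theorem exists_rpow_mul_lintegral_middle_rpow_le (n : ℕ) {p A : ℝ} (hp : 0 < p) :
    ∃ C : ℝ≥0∞, C ≠ ⊤ ∧ ∀ (F : Euc n → ℝ≥0∞) (K : ℝ≥0∞),
      (∀ R : ℝ, 0 < R → ∫⁻ x in ann 0 R, F x ^ p ≤ (K * ENNReal.ofReal R ^ (n / p - A)) ^ p) →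
      ∀ (R : ℝ), 0 < R → ∀ a : ℝ, ENNReal.ofReal (3 * R) ^ a *
        (∫⁻ x, middle F R x ^ p) ^ (1 / p) ≤
          ENNReal.ofReal 3 ^ a * C * (K * ENNReal.ofReal R ^ (n / p + a - A)) := by
  obtain ⟨C, hC, hm⟩ := exists_lintegral_middle_rpow_le n (A := A) hp
  refine ⟨C, hC, fun F K hK R hR a => ?_⟩
  grw [hm F K hK R hR]
  rw [← ENNReal.rpow_mul, mul_one_div_cancel hp.ne', ENNReal.rpow_one,
    ofReal_mul_rpow (by norm_num), show n / p + a - A = a + (n / p - A) by ring,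
    ← ofReal_rpow_mul hR]
  exact le_of_eq (by ring)

/-- The truncated estimate with radius 3R, applied to the ring part, gives the exponent (α-γ) + n/p
- A, which is n/q - (A-α) since n/p - n/q = γ. -/
theorem exists_strong_local (n : ℕ) [NeZero n] {α γ p q A : ℝ}
    (hα : 0 < α) (hγ : 0 ≤ γ) (hγα : γ ≤ α) (hp : 1 < p) (hpγ : p * γ < n)
    (hpq : 1 / p - 1 / q = γ / n) (hq : 0 < q) :
    ∃ C : ℝ≥0∞, C ≠ ⊤ ∧ ∀ F : Euc n → ℝ≥0∞, Measurable F → ∀ K : ℝ≥0∞, K ≠ ⊤ →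
      (∀ R : ℝ, 0 < R → ∫⁻ x in ann 0 R, F x ^ p ≤ (K * ENNReal.ofReal R ^ (n / p - A)) ^ p) →
      ∀ R : ℝ, 0 < R →
        ∫⁻ x, (∫⁻ y in ball x (3 * R), ‖x - y‖ₑ ^ (α - n) * middle F R y) ^ q ≤
          (C * (K * ENNReal.ofReal R ^ (n / q - (A - α)))) ^ q := by
  have hn : (0 : ℝ) < n := by exact_mod_cast NeZero.pos n
  obtain ⟨C, hC, h⟩ := exists_lintegral_truncated_fracIntegral_rpow_le n hα hγ hγα hp hpγ hpq hq
  obtain ⟨C', hC', h'⟩ := exists_rpow_mul_lintegral_middle_rpow_le n (A := A) (p := p) (by linarith)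
  have h3 := ofReal_rpow_ne_top (r := 3) (by norm_num) (α - γ)
  refine ⟨C * (ENNReal.ofReal 3 ^ (α - γ) * C'), by finiteness, fun F hF K hKt hK R hR => ?_⟩
  refine (h _ (measurable_middle hF R) (lintegral_middle_rpow_ne_top (by linarith) hKt hK hR)
    (3 * R) (by positivity)).trans ?_
  have hexp : n / q - (A - α) = n / p + (α - γ) - A := by
    have h1 : n * (1 / p - 1 / q) = n * (γ / n) := by rw [hpq]
    rw [mul_div_cancel₀ _ hn.ne'] at h1
    linear_combination -h1
  grw [h' F K hK R hR, hexp]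
  rw [mul_assoc C]

theorem exists_weak_local (n : ℕ) [NeZero n] {α γ q A : ℝ}
    (hα : 0 < α) (hγ : 0 ≤ γ) (hγα : γ ≤ α) (hpγ : 1 * γ < n)
    (hpq : 1 / 1 - 1 / q = γ / n) (hq : 0 < q) :
    ∃ C : ℝ≥0∞, C ≠ ⊤ ∧ ∀ F : Euc n → ℝ≥0∞, Measurable F → ∀ K : ℝ≥0∞, K ≠ ⊤ →
      (∀ R : ℝ, 0 < R → ∫⁻ x in ann 0 R, F x ^ (1 : ℝ) ≤
        (K * ENNReal.ofReal R ^ (n / 1 - A)) ^ (1 : ℝ)) →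
      ∀ R : ℝ, 0 < R → ∀ t : ℝ≥0∞, t ≠ 0 → t ≠ ⊤ → t ^ q *
        volume {x | t < ∫⁻ y in ball x (3 * R), ‖x - y‖ₑ ^ (α - n) * middle F R y} ≤
          (C * (K * ENNReal.ofReal R ^ (n / q - (A - α)))) ^ q := by
  have hn : (0 : ℝ) < n := by exact_mod_cast NeZero.pos n
  obtain ⟨C, hC, h⟩ := exists_rpow_mul_volume_truncated_fracIntegral_le n hα hγ hγα hpγ hpq hq
  obtain ⟨C', hC', h'⟩ := exists_rpow_mul_lintegral_middle_rpow_le n (A := A) one_pos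
  have h3 := ofReal_rpow_ne_top (r := 3) (by norm_num) (α - γ)
  refine ⟨C * (ENNReal.ofReal 3 ^ (α - γ) * C'), by finiteness,
    fun F hF K hKt hK R hR t ht₀ ht => ?_⟩
  have hfin := lintegral_middle_rpow_ne_top one_pos hKt hK hR
  have h1 := h' F K hK R hR (α - γ)
  simp only [ENNReal.rpow_one, div_one] at hfin h1
  refine (h _ (measurable_middle hF R) hfin (3 * R) (by positivity) t ht₀ ht).trans ?_
  have hexp : n / q - (A - α) = n + (α - γ) - A := by
    have h1 : n * (1 / 1 - 1 / q) = n * (γ / n) := by rw [hpq]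
    rw [mul_div_cancel₀ _ hn.ne'] at h1
    linear_combination -h1
  grw [h1, hexp]
  rw [mul_assoc C]

section Bounds

variable {α γ p q l β A : ℝ}

/-- The function g is arbitrary so that the potential and the maximal function are treated at once.
-/
theorem exists_normKS_le_of_pointwise (n : ℕ) [NeZero n]
    (hα : 0 < α) (hγ : 0 ≤ γ) (hγα : γ ≤ α) (hp : 1 < p) (hpγ : p * γ < n)
    (hpq : 1 / p - 1 / q = γ / n) (hq : 1 ≤ q) (hl : 0 < l) (hβ : 0 < β * q + n)
    (hA : (n - l) * (1 / q + β / n) = A - α) {C₀ : ℝ≥0∞} (hC₀ : C₀ ≠ ⊤) :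
    ∃ C : ℝ≥0∞, C ≠ ⊤ ∧ ∀ F : Euc n → ℝ≥0∞, Measurable F → ∀ K : ℝ≥0∞, K ≠ ⊤ →
      (∀ R : ℝ, 0 < R → ∫⁻ x in ann 0 R, F x ^ p ≤ (K * ENNReal.ofReal R ^ (n / p - A)) ^ p) →
      ∀ g : Euc n → ℝ≥0∞, (∀ (R : ℝ) (x : Euc n), x ∈ ann 0 R →
        g x ≤ C₀ * (∫⁻ y in ball x (3 * R), ‖x - y‖ₑ ^ (α - n) * middle F R y) +
          C₀ * K * ENNReal.ofReal R ^ (α - A)) → normKS q l β g ≤ C * K := by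
  have hq0 : 0 < q := by linarith
  obtain ⟨C, hC, h⟩ := exists_strong_local n (A := A) hα hγ hγα hp hpγ hpq hq0
  obtain ⟨C', hC', h'⟩ := exists_normKS_le_of_local n hq hl hβ
  refine ⟨C' * (C₀ * (C + 1)), by finiteness, fun F hF K hKt hK g hg => ?_⟩
  rw [mul_assoc]
  refine h' g (fun R x => C₀ * ∫⁻ y in ball x (3 * R), ‖x - y‖ₑ ^ (α - n) * middle F R y) _
    (fun R x hx => (hg R x hx).trans ?_) fun R hR => ?_
  · rw [hA, neg_sub]
    gcongr
    exact le_mul_of_one_le_right zero_le le_add_self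
  · simp only [ENNReal.mul_rpow_of_nonneg C₀ _ hq0.le]
    rw [lintegral_const_mul' _ _ (by finiteness), hA]
    grw [h F hF K hKt hK R hR]
    rw [← ENNReal.mul_rpow_of_nonneg C₀ _ hq0.le, ← mul_assoc, ← mul_assoc]
    gcongr
    exact le_self_add

theorem exists_normWKS_le_of_pointwise (n : ℕ) [NeZero n]
    (hα : 0 < α) (hγ : 0 ≤ γ) (hγα : γ ≤ α) (hpγ : 1 * γ < n)
    (hpq : 1 / 1 - 1 / q = γ / n) (hq : 1 ≤ q) (hl : 0 < l) (hβ : 0 < β * q + n)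
    (hA : (n - l) * (1 / q + β / n) = A - α) {C₀ : ℝ≥0∞} (hC₀ : C₀ ≠ ⊤) :
    ∃ C : ℝ≥0∞, C ≠ ⊤ ∧ ∀ F : Euc n → ℝ≥0∞, Measurable F → ∀ K : ℝ≥0∞, K ≠ ⊤ →
      (∀ R : ℝ, 0 < R → ∫⁻ x in ann 0 R, F x ^ (1 : ℝ) ≤
        (K * ENNReal.ofReal R ^ (n / 1 - A)) ^ (1 : ℝ)) →
      ∀ g : Euc n → ℝ≥0∞, Measurable g → (∀ (R : ℝ) (x : Euc n), x ∈ ann 0 R →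
        g x ≤ C₀ * (∫⁻ y in ball x (3 * R), ‖x - y‖ₑ ^ (α - n) * middle F R y) +
          C₀ * K * ENNReal.ofReal R ^ (α - A)) → normWKS q l β g ≤ C * K := by
  have hq0 : 0 < q := by linarith
  obtain ⟨C, hC, h⟩ := exists_weak_local n (A := A) hα hγ hγα hpγ hpq hq0
  obtain ⟨C', hC', h'⟩ := exists_normWKS_le_of_local n hq hl hβ
  -- Replacing C₀ by C₀+1 allows division by it inside the level sets.
  refine ⟨C' * ((C₀ + 1) * (C + 1)), by finiteness, fun F hF K hKt hK g hgm hg => ?_⟩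
  rw [mul_assoc]
  refine h' g hgm (fun R x => (C₀ + 1) *
      ∫⁻ y in ball x (3 * R), ‖x - y‖ₑ ^ (α - n) * middle F R y) _
    (fun R x hx => (hg R x hx).trans ?_) fun R hR t ht₀ ht => ?_
  · rw [hA, neg_sub]
    gcongr
    · exact le_self_add
    · exact le_self_add.trans (le_mul_of_one_le_right zero_le le_add_self)
  · have hC1 : C₀ + 1 ≠ 0 := by simp
    have hC2 : C₀ + 1 ≠ ⊤ := by finiteness
    have hset : {x | t < (C₀ + 1) *
        ∫⁻ y in ball x (3 * R), ‖x - y‖ₑ ^ (α - n) * middle F R y} =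
        {x | t / (C₀ + 1) < ∫⁻ y in ball x (3 * R), ‖x - y‖ₑ ^ (α - n) * middle F R y} := by
      ext x
      rw [mem_ofPred_eq, mem_ofPred_eq, ENNReal.div_lt_iff (Or.inl hC1) (Or.inl hC2), mul_comm]
    have ht' : t ^ q = (C₀ + 1) ^ q * (t / (C₀ + 1)) ^ q := by
      rw [← ENNReal.mul_rpow_of_nonneg _ _ hq0.le, ENNReal.mul_div_cancel hC1 hC2]
    rw [hset, ht', hA, mul_assoc]
    grw [h F hF K hKt hK R hR (t / (C₀ + 1)) (by simp [ht₀, hC2]) (ENNReal.div_ne_top ht hC1)]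
    rw [← ENNReal.mul_rpow_of_nonneg _ _ hq0.le, ← mul_assoc, ← mul_assoc]
    gcongr
    exact le_self_add

end Bounds

end LocalMorrey

/-! ### Measurability, convergence and sufficiency -/

namespace LocalMorrey

open Metric Set

variable {n : ℕ} {𝕜 : Type*} [RCLike 𝕜]

theorem measurable_potential (α : ℝ) {F : Euc n → ℝ≥0∞} (hF : Measurable F) :
    Measurable (potential α F) := by
  have h : Measurable fun z : Euc n × Euc n => ‖z.1 - z.2‖ₑ ^ (α - n) * F z.2 :=
    ((measurable_fst.sub measurable_snd).enorm.pow_const _).mul (hF.comp measurable_snd)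
  exact h.lintegral_prod_right'

theorem potential_congr_ae (α : ℝ) {F G : Euc n → ℝ≥0∞} (h : F =ᵐ[volume] G) :
    potential α F = potential α G := by
  ext x
  refine lintegral_congr_ae ?_
  filter_upwards [h] with y hy
  rw [hy]

theorem maximalPotential_congr_ae (α : ℝ) {F G : Euc n → ℝ≥0∞} (h : F =ᵐ[volume] G) :
    maximalPotential α F = maximalPotential α G := by
  ext x
  unfold maximalPotential
  congr 1; ext c; congr 1; ext r; congr 1; ext hx
  congr 1
  exact lintegral_congr_ae (ae_restrict_of_ae h)

theorem enorm_fracIntegrand {α : ℝ} (f : Euc n → 𝕜) {x y : Euc n} (hxy : y ≠ x) :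
    ‖fracIntegrand α f x y‖ₑ = ‖x - y‖ₑ ^ (α - n) * ‖f y‖ₑ := by
  have h : 0 < ‖x - y‖ := norm_pos_iff.2 (sub_ne_zero.2 hxy.symm)
  rw [fracIntegrand, enorm_smul, ← Real.rpow_neg h.le, neg_sub,
    Real.enorm_eq_ofReal (Real.rpow_nonneg h.le _), ← ENNReal.ofReal_rpow_of_pos h, ofReal_norm]

theorem lintegral_enorm_fracIntegrand [NeZero n] (α : ℝ) (f : Euc n → 𝕜) (x : Euc n) :
    ∫⁻ y, ‖fracIntegrand α f x y‖ₑ = potential α (fun y => ‖f y‖ₑ) x := by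
  refine lintegral_congr_ae ?_
  filter_upwards [ae_ne x] with y hy
  exact enorm_fracIntegrand f hy

theorem enorm_fracIntegral_le [NeZero n] (α : ℝ) (f : Euc n → 𝕜) (x : Euc n) :
    ‖fracIntegral α f x‖ₑ ≤ potential α (fun y => ‖f y‖ₑ) x :=
  (enorm_integral_le_lintegral_enorm _).trans (lintegral_enorm_fracIntegrand α f x).le

theorem aestronglyMeasurable_fracIntegrand (α : ℝ) {f : Euc n → 𝕜}
    (hf : AEStronglyMeasurable f volume) (x : Euc n) :
    AEStronglyMeasurable (fracIntegrand α f x) volume := by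
  have h : Measurable fun y : Euc n => (‖x - y‖ ^ ((n : ℝ) - α))⁻¹ :=
    (((measurable_const.sub measurable_id).norm.pow_const _).inv)
  exact h.aestronglyMeasurable.smul hf

theorem aestronglyMeasurable_fracIntegral (α : ℝ) {f : Euc n → 𝕜}
    (hf : AEStronglyMeasurable f volume) :
    AEStronglyMeasurable (fracIntegral α f) volume := by
  have h : Measurable fun z : Euc n × Euc n => (‖z.1 - z.2‖ ^ ((n : ℝ) - α))⁻¹ :=
    (((measurable_fst.sub measurable_snd).norm.pow_const _).inv)
  have h1 : AEStronglyMeasurable (fun z : Euc n × Euc n => fracIntegrand α f z.1 z.2)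
      (volume.prod volume) :=
    h.aestronglyMeasurable.smul hf.comp_snd
  exact h1.integral_prod_right'

theorem integrable_fracIntegrand_iff [NeZero n] {α : ℝ} {f : Euc n → 𝕜}
    (hf : AEStronglyMeasurable f volume) (x : Euc n) :
    Integrable (fracIntegrand α f x) volume ↔ potential α (fun y => ‖f y‖ₑ) x < ⊤ := by
  rw [← lintegral_enorm_fracIntegrand, ← hasFiniteIntegral_iff_enorm]
  exact ⟨fun h => h.2, fun h => ⟨aestronglyMeasurable_fracIntegrand α hf x, h⟩⟩

theorem fracMaximal_eq (α : ℝ) (f : Euc n → 𝕜) :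
    fracMaximal α f = maximalPotential α fun y => ‖f y‖ₑ := rfl

/-- Both operators depend only on the almost everywhere class of |f|, so a Borel representative with
the same annular bounds may replace it. -/
theorem exists_measurable_majorant (n : ℕ) [NeZero n] {p l β : ℝ} (hp : 0 < p) (hl : 0 < l)
    (h : 0 < β * p + n) :
    ∃ C : ℝ≥0∞, C ≠ ⊤ ∧ ∀ f : Euc n → 𝕜, AEStronglyMeasurable f volume →
      ∃ F : Euc n → ℝ≥0∞, Measurable F ∧ (fun y => ‖f y‖ₑ) =ᵐ[volume] F ∧
        ∀ R : ℝ, 0 < R → ∫⁻ x in ann 0 R, F x ^ p ≤ (C * normKS p l β f *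
          ENNReal.ofReal R ^ (n / p - (n - l) * (1 / p + β / n))) ^ p := by
  obtain ⟨C, hC, hann⟩ := exists_ann_le_normKS n hp hl h
  refine ⟨C, hC, fun f hf => ⟨hf.enorm.mk _, hf.enorm.measurable_mk, hf.enorm.ae_eq_mk,
    fun R hR => le_trans (le_of_eq (lintegral_congr_ae ?_)) (hann f R hR)⟩⟩
  filter_upwards [ae_restrict_of_ae hf.enorm.ae_eq_mk] with x hx
  rw [← hx]

section Sufficiency

variable {α γ p q l₁ l₂ β₁ β₂ : ℝ}

theorem fracIntegralBounded_strong [NeZero n] (hα : 0 < α) (hγ : 0 ≤ γ)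
    (hγα : γ ≤ α) (hp : 1 < p) (hpγ : p * γ < n) (hpq : 1 / p - 1 / q = γ / n) (hq : 1 ≤ q)
    (hl₁ : 0 < l₁) (hl₂ : 0 < l₂) (hβ₁ : 0 < β₁ * p + n) (hβ₂ : 0 < β₂ * q + n)
    (hA : (n - l₂) * (1 / q + β₂ / n) = (n - l₁) * (1 / p + β₁ / n) - α)
    (hA₁ : α < (n - l₁) * (1 / p + β₁ / n)) (hA₂ : (n - l₁) * (1 / p + β₁ / n) < n) :
    FracIntegralBounded (n := n) (𝕜 := 𝕜) α (normKS p l₁ β₁) (normKS q l₂ β₂) := by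
  have hq0 : 0 < q := by linarith
  obtain ⟨C, hC, hF⟩ := exists_measurable_majorant (𝕜 := 𝕜) n (p := p) (by linarith) hl₁ hβ₁
  obtain ⟨C', hC', hpt⟩ := exists_potential_le_on_ann n hp.le hA₁ hA₂
  -- The pointwise bound has coefficient 1 on the ring part and C' on the remainder; C'+1 dominates
  -- both.
  obtain ⟨D, hD, hb⟩ := exists_normKS_le_of_pointwise n hα hγ hγα hp hpγ hpq hq hl₂ hβ₂ hA
    (C₀ := C' + 1) (by finiteness)
  refine ⟨(D * C).toNNReal, fun f hf => ?_⟩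
  obtain ⟨F, hFm, hfF, hK⟩ := hF f hf.1
  have hKt : C * normKS p l₁ β₁ f ≠ ⊤ := ENNReal.mul_ne_top hC hf.2.ne
  have hN := hb F hFm _ hKt hK (potential α F) fun R x hx => (hpt F hFm _ hK R x hx).trans (by
    gcongr
    · exact le_mul_of_one_le_left zero_le le_add_self
    · exact le_self_add)
  rw [← potential_congr_ae α hfF] at hN
  have hpm : Measurable (potential α fun y => ‖f y‖ₑ) := by
    rw [potential_congr_ae α hfF]; exact measurable_potential α hFm
  have hle : normKS q l₂ β₂ (fracIntegral α f) ≤ D * (C * normKS p l₁ β₁ f) :=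
    (normKS_mono hq0.le (enorm_fracIntegral_le α f)).trans hN
  have hfin : D * (C * normKS p l₁ β₁ f) ≠ ⊤ := ENNReal.mul_ne_top hD hKt
  refine ⟨Filter.Eventually.mono ?_ fun x => (integrable_fracIntegrand_iff hf.1 x).2,
    ⟨aestronglyMeasurable_fracIntegral α hf.1, hle.trans_lt hfin.lt_top⟩, ?_⟩
  -- Absolute convergence: the potential of |f| has finite norm, hence is finite almost everywhere.
  · exact ae_lt_top_of_normWKS hq0 hl₂ hβ₂ hpm (ne_top_of_le_ne_top hfin
      ((normWKS_le_normKS hq0 (by simpa using hpm.aemeasurable)).trans hN))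
  · rwa [ENNReal.coe_toNNReal (ENNReal.mul_ne_top hD hC), mul_assoc]

theorem fracIntegralBounded_weak [NeZero n] (hα : 0 < α) (hγ : 0 ≤ γ)
    (hγα : γ ≤ α) (hpγ : 1 * γ < n) (hpq : 1 / 1 - 1 / q = γ / n) (hq : 1 ≤ q)
    (hl₁ : 0 < l₁) (hl₂ : 0 < l₂) (hβ₁ : 0 < β₁ * 1 + n) (hβ₂ : 0 < β₂ * q + n)
    (hA : (n - l₂) * (1 / q + β₂ / n) = (n - l₁) * (1 / 1 + β₁ / n) - α)
    (hA₁ : α < (n - l₁) * (1 / 1 + β₁ / n)) (hA₂ : (n - l₁) * (1 / 1 + β₁ / n) < n) :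
    FracIntegralBounded (n := n) (𝕜 := 𝕜) α (normKS 1 l₁ β₁) (normWKS q l₂ β₂) := by
  have hq0 : 0 < q := by linarith
  obtain ⟨C, hC, hF⟩ := exists_measurable_majorant (𝕜 := 𝕜) n one_pos hl₁ hβ₁
  obtain ⟨C', hC', hpt⟩ := exists_potential_le_on_ann n le_rfl hA₁ hA₂
  obtain ⟨D, hD, hb⟩ := exists_normWKS_le_of_pointwise n hα hγ hγα hpγ hpq hq hl₂ hβ₂ hA
    (C₀ := C' + 1) (by finiteness)
  refine ⟨(D * C).toNNReal, fun f hf => ?_⟩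
  obtain ⟨F, hFm, hfF, hK⟩ := hF f hf.1
  have hKt : C * normKS 1 l₁ β₁ f ≠ ⊤ := ENNReal.mul_ne_top hC hf.2.ne
  have hN := hb F hFm _ hKt hK (potential α F) (measurable_potential α hFm)
    fun R x hx => (hpt F hFm _ hK R x hx).trans (by
      gcongr
      · exact le_mul_of_one_le_left zero_le le_add_self
      · exact le_self_add)
  rw [← potential_congr_ae α hfF] at hN
  have hpm : Measurable (potential α fun y => ‖f y‖ₑ) := by
    rw [potential_congr_ae α hfF]; exact measurable_potential α hFm
  have hle : normWKS q l₂ β₂ (fracIntegral α f) ≤ D * (C * normKS 1 l₁ β₁ f) :=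
    (normWKS_mono hq0.le (.of_forall (enorm_fracIntegral_le α f))).trans hN
  have hfin : D * (C * normKS 1 l₁ β₁ f) ≠ ⊤ := ENNReal.mul_ne_top hD hKt
  refine ⟨Filter.Eventually.mono ?_ fun x => (integrable_fracIntegrand_iff hf.1 x).2,
    ⟨aestronglyMeasurable_fracIntegral α hf.1, hle.trans_lt hfin.lt_top⟩, ?_⟩
  · exact ae_lt_top_of_normWKS hq0 hl₂ hβ₂ hpm (ne_top_of_le_ne_top hfin hN)
  · rwa [ENNReal.coe_toNNReal (ENNReal.mul_ne_top hD hC), mul_assoc]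

theorem fracMaximalBounded_strong [NeZero n] (hα : 0 < α) (hαn : α < n) (hγ : 0 ≤ γ)
    (hγα : γ ≤ α) (hp : 1 < p) (hpγ : p * γ < n) (hpq : 1 / p - 1 / q = γ / n) (hq : 1 ≤ q)
    (hl₁ : 0 < l₁) (hl₂ : 0 < l₂) (hβ₁ : 0 < β₁ * p + n) (hβ₂ : 0 < β₂ * q + n)
    (hA : (n - l₂) * (1 / q + β₂ / n) = (n - l₁) * (1 / p + β₁ / n) - α)
    (hA₁ : α ≤ (n - l₁) * (1 / p + β₁ / n)) (hA₂ : (n - l₁) * (1 / p + β₁ / n) < n) :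
    FracMaximalBounded (n := n) (𝕜 := 𝕜) α (normKS p l₁ β₁) (normKS q l₂ β₂) := by
  obtain ⟨C, hC, hF⟩ := exists_measurable_majorant (𝕜 := 𝕜) n (p := p) (by linarith) hl₁ hβ₁
  obtain ⟨C', hC', hpt⟩ := exists_maximalPotential_le_on_ann n hαn hp.le hA₁ hA₂
  obtain ⟨D, hD, hb⟩ := exists_normKS_le_of_pointwise n hα hγ hγα hp hpγ hpq hq hl₂ hβ₂ hA hC'
  refine ⟨(D * C).toNNReal, fun f hf => ?_⟩
  obtain ⟨F, hFm, hfF, hK⟩ := hF f hf.1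
  have hKt : C * normKS p l₁ β₁ f ≠ ⊤ := ENNReal.mul_ne_top hC hf.2.ne
  have hN := hb F hFm _ hKt hK (maximalPotential α F) (hpt F hFm _ hK)
  rw [← maximalPotential_congr_ae α hfF, ← fracMaximal_eq] at hN
  have hfin : D * (C * normKS p l₁ β₁ f) ≠ ⊤ := ENNReal.mul_ne_top hD hKt
  refine ⟨⟨(measurable_maximalPotential α _).aestronglyMeasurable, hN.trans_lt hfin.lt_top⟩, ?_⟩
  rwa [ENNReal.coe_toNNReal (ENNReal.mul_ne_top hD hC), mul_assoc]

theorem fracMaximalBounded_weak [NeZero n] (hα : 0 < α) (hαn : α < n) (hγ : 0 ≤ γ)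
    (hγα : γ ≤ α) (hpγ : 1 * γ < n) (hpq : 1 / 1 - 1 / q = γ / n) (hq : 1 ≤ q)
    (hl₁ : 0 < l₁) (hl₂ : 0 < l₂) (hβ₁ : 0 < β₁ * 1 + n) (hβ₂ : 0 < β₂ * q + n)
    (hA : (n - l₂) * (1 / q + β₂ / n) = (n - l₁) * (1 / 1 + β₁ / n) - α)
    (hA₁ : α ≤ (n - l₁) * (1 / 1 + β₁ / n)) (hA₂ : (n - l₁) * (1 / 1 + β₁ / n) < n) :
    FracMaximalBounded (n := n) (𝕜 := 𝕜) α (normKS 1 l₁ β₁) (normWKS q l₂ β₂) := by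
  obtain ⟨C, hC, hF⟩ := exists_measurable_majorant (𝕜 := 𝕜) n one_pos hl₁ hβ₁
  obtain ⟨C', hC', hpt⟩ := exists_maximalPotential_le_on_ann n hαn le_rfl hA₁ hA₂
  obtain ⟨D, hD, hb⟩ := exists_normWKS_le_of_pointwise n hα hγ hγα hpγ hpq hq hl₂ hβ₂ hA hC'
  refine ⟨(D * C).toNNReal, fun f hf => ?_⟩
  obtain ⟨F, hFm, hfF, hK⟩ := hF f hf.1
  have hKt : C * normKS 1 l₁ β₁ f ≠ ⊤ := ENNReal.mul_ne_top hC hf.2.ne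
  have hN := hb F hFm _ hKt hK (maximalPotential α F) (measurable_maximalPotential α F)
    (hpt F hFm _ hK)
  rw [← maximalPotential_congr_ae α hfF, ← fracMaximal_eq] at hN
  have hfin : D * (C * normKS 1 l₁ β₁ f) ≠ ⊤ := ENNReal.mul_ne_top hD hKt
  refine ⟨⟨(measurable_maximalPotential α _).aestronglyMeasurable, hN.trans_lt hfin.lt_top⟩, ?_⟩
  rwa [ENNReal.coe_toNNReal (ENNReal.mul_ne_top hD hC), mul_assoc]

end Sufficiency

end LocalMorrey

/-! ### Necessity: testing on power functions -/

namespace LocalMorrey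

open Metric Set

variable {n : ℕ} {𝕜 : Type*} [RCLike 𝕜]

theorem disjoint_ann {x : Euc n} {r s : ℝ} (h : r ≤ s / 2) : Disjoint (ann x r) (ann x s) := by
  rw [Set.disjoint_left]
  intro y hy hy'
  rw [mem_ann] at hy hy'
  linarith

theorem pairwise_disjoint_ann_pow (x : Euc n) {r : ℝ} (hr : 0 < r) :
    Pairwise (Function.onFun Disjoint fun k : ℕ => ann x (r * 2 ^ k)) := by
  rw [pairwise_disjoint_on]
  intro k m hkm
  refine disjoint_ann ?_
  have : (2 : ℝ) ^ (k + 1) ≤ 2 ^ m := pow_le_pow_right₀ one_le_two hkm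
  rw [pow_succ] at this
  nlinarith

theorem pairwise_disjoint_ann_half_pow (x : Euc n) {r : ℝ} (hr : 0 < r) :
    Pairwise (Function.onFun Disjoint fun k : ℕ => ann x (r * (1 / 2) ^ k)) := by
  rw [pairwise_disjoint_on]
  intro k m hkm
  refine (disjoint_ann ?_).symm
  have : (1 / 2 : ℝ) ^ m ≤ (1 / 2) ^ (k + 1) :=
    pow_le_pow_of_le_one (by norm_num) (by norm_num) hkm
  rw [pow_succ] at this
  nlinarith

theorem setLIntegral_eq_top_of_disjoint {F : Euc n → ℝ≥0∞} {c : ℝ≥0∞} (hc : c ≠ 0)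
    {S : ℕ → Set (Euc n)} {T : Set (Euc n)} (hS : ∀ k, MeasurableSet (S k))
    (hd : Pairwise (Function.onFun Disjoint S)) (hST : ∀ k, S k ⊆ T)
    (h : ∀ k, c ≤ ∫⁻ y in S k, F y) : ∫⁻ y in T, F y = ⊤ := by
  rw [← top_le_iff]
  calc (⊤ : ℝ≥0∞) = ∑' _ : ℕ, c := (ENNReal.tsum_const_eq_top_of_ne_zero hc).symm
    _ ≤ ∑' k, ∫⁻ y in S k, F y := ENNReal.tsum_le_tsum h
    _ = ∫⁻ y in ⋃ k, S k, F y := (lintegral_iUnion hS hd F).symm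
    _ ≤ _ := lintegral_mono_set (iUnion_subset hST)

/-- The extended power function `x ↦ |x|^(-A)`. -/
noncomputable def radialPower (A : ℝ) (x : Euc n) : ℝ≥0∞ := ‖x‖ₑ ^ (-A)

theorem measurable_radialPower (A : ℝ) : Measurable (radialPower (n := n) A) :=
  measurable_enorm.pow_const _

theorem exists_le_setLIntegral_ann_radialPower (n : ℕ) [NeZero n] (A : ℝ) :
    ∃ c : ℝ≥0∞, c ≠ 0 ∧ c ≠ ⊤ ∧ ∀ R : ℝ, 0 < R →
      c * ENNReal.ofReal R ^ (n - A) ≤ ∫⁻ y in ann (0 : Euc n) R, radialPower A y := by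
  have hv := volume_unitBall_ne_zero (n := n)
  have hv' := volume_unitBall_ne_top (n := n)
  have h2 : (2 : ℝ≥0∞) ^ |-A| ≠ 0 := by simp
  have h2' : (2 : ℝ≥0∞) ^ |-A| ≠ ⊤ := by simp
  refine ⟨(2 ^ |-A|)⁻¹ * (volume (ball (0 : Euc n) 1) / 2), by simp [hv], by finiteness,
    fun R hR => ?_⟩
  have h := rpow_mul_setLIntegral_ann_le (n := n) 0 hR (-A) fun _ => 1
  simp only [mul_one, zero_sub, enorm_neg, setLIntegral_one] at h
  calc _ = (2 ^ |-A|)⁻¹ * (ENNReal.ofReal R ^ (-A) *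
        (ENNReal.ofReal R ^ (n : ℝ) * (volume (ball (0 : Euc n) 1) / 2))) := by
        rw [show n - A = -A + n by ring, ← ofReal_rpow_mul hR]; ring
    _ ≤ (2 ^ |-A|)⁻¹ * (2 ^ |-A| * ∫⁻ y in ann (0 : Euc n) R, ‖y‖ₑ ^ (-A)) := by
        grw [le_volume_ann 0 hR, h]
    _ = _ := by
        rw [← mul_assoc, ENNReal.inv_mul_cancel h2 h2', one_mul]
        rfl

/-- This power has the extremal size R^(n/p-A) on every annulus at once, so it is admissible
whatever the sign or size of A. -/
theorem normKS_radialPower_ne_top (n : ℕ) [NeZero n] {p l β : ℝ} (hp : 0 < p) (hl : 0 < l)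
    (h : 0 < β * p + n) :
    normKS (n := n) p l β (radialPower ((n - l) * (1 / p + β / n))) ≠ ⊤ := by
  obtain ⟨C, hC, hann⟩ := exists_normKS_le_of_ann n hp hl h
  have hv' := volume_unitBall_ne_top (n := n)
  set A := (n - l) * (1 / p + β / n)
  refine ne_top_of_le_ne_top ?_ (hann (radialPower A)
    ((2 ^ |-A * p| * volume (ball (0 : Euc n) 1)) ^ (1 / p)) fun R hR => ?_)
  · finiteness
  have h1 := setLIntegral_rpow_mul_ann_le (n := n) 0 hR (-A * p) fun _ => 1
  simp only [mul_one, zero_sub, enorm_neg, setLIntegral_one] at h1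
  calc ∫⁻ x in ann 0 R, ‖radialPower A x‖ₑ ^ p = ∫⁻ x in ann (0 : Euc n) R, ‖x‖ₑ ^ (-A * p) := by
        simp only [enorm_eq_self, radialPower, ENNReal.rpow_mul]
    _ ≤ 2 ^ |-A * p| * ENNReal.ofReal R ^ (-A * p) *
          (ENNReal.ofReal R ^ (n : ℝ) * volume (ball (0 : Euc n) 1)) := by
        grw [h1, volume_ann_le 0 hR]
    _ = _ := by
        rw [ENNReal.mul_rpow_of_nonneg _ _ hp.le, rpow_one_div_rpow _ hp.ne', ← ENNReal.rpow_mul,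
          show (n / p - A) * p = -A * p + n by field_simp; ring, ← ofReal_rpow_mul hR]
        ring

theorem setLIntegral_ball_radialPower_eq_top [NeZero n] {A : ℝ} (hA : n ≤ A) :
    ∫⁻ y in ball (0 : Euc n) 1, radialPower A y = ⊤ := by
  obtain ⟨c, hc, hc', h⟩ := exists_le_setLIntegral_ann_radialPower n A
  have hk : ∀ k : ℕ, (1 : ℝ) * (1 / 2) ^ k ≤ 1 := fun k => by
    rw [one_mul]; exact pow_le_one₀ (by norm_num) (by norm_num)
  refine setLIntegral_eq_top_of_disjoint hc (fun k => measurableSet_ann 0 (1 * (1 / 2) ^ k))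
    (pairwise_disjoint_ann_half_pow 0 one_pos)
    (fun k => sdiff_subset.trans (ball_subset_ball (hk k))) fun k => ?_
  refine le_trans ?_ (h _ (by positivity))
  refine le_mul_of_one_le_right zero_le ?_
  have h1 := rpow_le_rpow_of_nonpos (z := n - A) (by linarith) (ENNReal.ofReal_le_ofReal (hk k))
  simpa using h1

/-- At A = α each annulus of radius r ≥ |x| contributes at least a constant, r^(n-α) from the power
against (2r)^(α-n) from the kernel. -/
theorem potential_radialPower_eq_top [NeZero n] {α : ℝ} (hαn : α < n) {x : Euc n} (hx : x ≠ 0) :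
    potential α (radialPower α) x = ⊤ := by
  obtain ⟨c, hc, hc', h⟩ := exists_le_setLIntegral_ann_radialPower n α
  have hx0 : 0 < ‖x‖ := norm_pos_iff.2 hx
  rw [potential, ← setLIntegral_univ]
  have h2 := ofReal_rpow_ne_zero two_pos (α - n)
  refine setLIntegral_eq_top_of_disjoint (c := ENNReal.ofReal 2 ^ (α - n) * c) (mul_ne_zero h2 hc)
    (fun k => measurableSet_ann 0 (‖x‖ * 2 ^ k))
    (pairwise_disjoint_ann_pow 0 hx0) (fun k => subset_univ _) fun k => ?_
  set r := ‖x‖ * 2 ^ k with hr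
  have hr0 : 0 < r := by positivity
  have hxr : ‖x‖ ≤ r := le_mul_of_one_le_right hx0.le (one_le_pow₀ one_le_two)
  calc ENNReal.ofReal 2 ^ (α - n) * c
      = ENNReal.ofReal (2 * r) ^ (α - n) * (c * ENNReal.ofReal r ^ (n - α)) := by
        rw [ofReal_mul_rpow two_pos, mul_comm c, mul_assoc, ← mul_assoc (ENNReal.ofReal r ^ _),
          ofReal_rpow_mul hr0]
        simp
    _ ≤ ENNReal.ofReal (2 * r) ^ (α - n) * ∫⁻ y in ann (0 : Euc n) r, radialPower α y := by
        grw [h r hr0]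
    _ = ∫⁻ y in ann (0 : Euc n) r, ENNReal.ofReal (2 * r) ^ (α - n) * radialPower α y :=
        (lintegral_const_mul' _ _ (ofReal_rpow_ne_top (by positivity) _)).symm
    _ ≤ _ := by
        refine setLIntegral_mono' (measurableSet_ann 0 r) fun y hy => ?_
        gcongr ?_ * _
        refine rpow_le_rpow_of_nonpos (by linarith) ?_
        rw [enorm_sub_eq_ofReal_dist]
        refine ENNReal.ofReal_le_ofReal ?_
        have h3 := dist_triangle_right y x 0
        rw [mem_ann] at hy
        rw [dist_zero_right x] at h3
        linarith

theorem eq_zero_of_rpow_le {a : ℝ} {B : ℝ≥0∞} (hB : B ≠ ⊤)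
    (h : ∀ R : ℝ, 0 < R → ENNReal.ofReal R ^ a ≤ B) : a = 0 := by
  by_contra ha
  have hB0 := ENNReal.toReal_nonneg (a := B)
  have hR : 0 < (B.toReal + 1) ^ (1 / a) := Real.rpow_pos_of_pos (by linarith) _
  have h1 := h _ hR
  rw [ENNReal.ofReal_rpow_of_pos hR, ← Real.rpow_mul (by linarith), one_div_mul_cancel ha,
    Real.rpow_one, ENNReal.ofReal_le_iff_le_toReal hB] at h1
  linarith

theorem nonneg_of_rpow_le {a R₀ : ℝ} {B : ℝ≥0∞} (hB : B ≠ ⊤)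
    (h : ∀ R : ℝ, R₀ < R → 0 < R → ENNReal.ofReal R ^ (-a) ≤ B) : 0 ≤ a := by
  by_contra! ha
  -- With a < 0 the power R^(-a) is increasing, so it is also bounded for R ≤ R₀ and the two-sided
  -- criterion applies.
  have hle : ∀ R : ℝ, 0 < R → ENNReal.ofReal R ^ (-a) ≤
      max B (ENNReal.ofReal (max R₀ 0) ^ (-a)) := by
    intro R hR
    rcases lt_or_ge R₀ R with hR' | hR'
    · exact le_max_of_le_left (h R hR' hR)
    · refine le_max_of_le_right (ENNReal.rpow_le_rpow (ENNReal.ofReal_le_ofReal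
        (hR'.trans (le_max_left _ _))) (by linarith))
  have h0 := eq_zero_of_rpow_le (max_lt hB.lt_top
    (ENNReal.rpow_lt_top_of_nonneg (by linarith) ENNReal.ofReal_ne_top)).ne hle
  linarith

/-- The centred ball of radius R contains x and is a competitor in the supremum. -/
theorem exists_rpow_le_maximalPotential_radialPower (n : ℕ) [NeZero n] {α : ℝ} (hαn : α < n)
    (A : ℝ) :
    ∃ C : ℝ≥0∞, C ≠ 0 ∧ C ≠ ⊤ ∧ ∀ (x : Euc n) (R : ℝ), x ∈ ball 0 R →
      ENNReal.ofReal R ^ (α - A) ≤ C * maximalPotential α (radialPower A) x := by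
  obtain ⟨c, hc, hc', h⟩ := exists_le_setLIntegral_ann_radialPower n A
  have hv := volume_unitBall_ne_zero (n := n)
  have hv' := volume_unitBall_ne_top (n := n)
  set w := volume (ball (0 : Euc n) 1) ^ (1 - α / n)
  have hw : w ≠ 0 := by simp [w, ENNReal.rpow_eq_zero_iff, hv, hv']
  have hw' : w ≠ ⊤ := ENNReal.rpow_ne_top_of_ne_zero hv hv'
  refine ⟨c⁻¹ * w, mul_ne_zero (ENNReal.inv_ne_zero.2 hc') hw, by finiteness, fun x R hx => ?_⟩
  have hR : 0 < R := pos_of_mem_ball hx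
  have h1 : (∫⁻ y in ball (0 : Euc n) R, radialPower A y) /
      volume (ball (0 : Euc n) R) ^ (1 - α / n) ≤ maximalPotential α (radialPower A) x :=
    le_iSup_of_le 0 (le_iSup_of_le R (le_iSup_of_le hx le_rfl))
  rw [volume_ball_rpow hαn 0 hR, ENNReal.div_le_iff (mul_ne_zero (ofReal_rpow_ne_zero hR _) hw)
    (ENNReal.mul_ne_top (ofReal_rpow_ne_top hR _) hw')] at h1
  have h2 : c * ENNReal.ofReal R ^ (n - A) ≤
      maximalPotential α (radialPower A) x * (ENNReal.ofReal R ^ (n - α) * w) :=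
    (h R hR).trans ((lintegral_mono_set sdiff_subset).trans h1)
  calc ENNReal.ofReal R ^ (α - A)
      = c⁻¹ * c * (ENNReal.ofReal R ^ (n - A) * ENNReal.ofReal R ^ (α - n)) := by
        rw [ENNReal.inv_mul_cancel hc hc', one_mul, ofReal_rpow_mul hR]
        congr 1; ring
    _ = c⁻¹ * (c * ENNReal.ofReal R ^ (n - A)) * ENNReal.ofReal R ^ (α - n) := by ring
    _ ≤ c⁻¹ * (maximalPotential α (radialPower A) x * (ENNReal.ofReal R ^ (n - α) * w)) *
          ENNReal.ofReal R ^ (α - n) := by gcongr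
    _ = c⁻¹ * w * maximalPotential α (radialPower A) x *
          (ENNReal.ofReal R ^ (n - α) * ENNReal.ofReal R ^ (α - n)) := by ring
    _ = _ := by rw [ofReal_rpow_mul hR]; simp

/-- The conditions on the exponents that are forced by a power function. -/
theorem exponents_of_normWKS_ne_top [NeZero n] {α q l β A : ℝ} (hαn : α < n) (hq : 0 < q)
    (hl : 0 < l) (h : 0 < β * q + n) {g : Euc n → ℝ≥0∞} (hg : Measurable g)
    (hN : normWKS q l β g ≠ ⊤) {C : ℝ≥0∞} (hC : C ≠ ⊤)
    (hle : ∀ x, maximalPotential α (radialPower A) x ≤ C * g x) :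
    (n - l) * (1 / q + β / n) = A - α ∧ α ≤ A ∧ A < n := by
  obtain ⟨x, hx⟩ := (ae_lt_top_of_normWKS hq hl h hg hN).exists
  have hxM : maximalPotential α (radialPower A) x ≠ ⊤ :=
    ne_top_of_le_ne_top (ENNReal.mul_ne_top hC hx.ne) (hle x)
  obtain ⟨D, hD, hD', hlow⟩ := exists_rpow_le_maximalPotential_radialPower n hαn A
  refine ⟨?_, ?_, ?_⟩
  · obtain ⟨C', hC', hann⟩ := exists_ann_le_normWKS n hq hl h
    set a := (n - l) * (1 / q + β / n)
    have hv := volume_unitBall_ne_zero (n := n)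
    have hv' := volume_unitBall_ne_top (n := n)
    set w := (volume (ball (0 : Euc n) 1) / 2) ^ (1 / q)
    have hw : w ≠ 0 := by
      simp [w, ENNReal.rpow_eq_zero_iff, hv, hq, not_lt.2 hq.le]
    have hw' : w ≠ ⊤ :=
      ENNReal.rpow_ne_top_of_nonneg (by positivity) (ENNReal.div_ne_top hv' two_ne_zero)
    -- The 2 makes g > R^(α-A)/E strict on the whole annulus, and C+1 keeps E nonzero. The weak norm
    -- at that height gives R^(α-A) R^(n/q) ≲ R^(n/q-a) for every R, so a = A-α.
    set E := D * (C + 1) * 2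
    have hE : E ≠ 0 := by simp [E, hD]
    have hE' : E ≠ ⊤ := by finiteness
    have key : ∀ R : ℝ, 0 < R →
        ENNReal.ofReal R ^ (a - (A - α)) ≤ E * (C' * normWKS q l β g) * w⁻¹ := by
      intro R hR
      have ht' : ENNReal.ofReal R ^ (α - A) / E ≠ ⊤ :=
        ENNReal.div_ne_top (ofReal_rpow_ne_top hR _) hE
      have ht0 : ENNReal.ofReal R ^ (α - A) / E ≠ 0 := by
        simp [ENNReal.div_eq_zero_iff, ofReal_rpow_ne_zero hR, hE']
      have hgt : ∀ y ∈ ann (0 : Euc n) R, ENNReal.ofReal R ^ (α - A) / E < g y := by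
        intro y hy
        have h1 : ENNReal.ofReal R ^ (α - A) ≤ D * (C + 1) * g y := by
          refine (hlow y R hy.1).trans ?_
          grw [hle y]
          rw [← mul_assoc]
          gcongr
          exact le_self_add
        rcases eq_or_ne (g y) ⊤ with hy' | hy'
        · rw [hy']; exact ht'.lt_top
        have hgy : g y ≠ 0 := by
          intro h0
          rw [h0, mul_zero] at h1
          exact ofReal_rpow_ne_zero hR _ (le_antisymm h1 zero_le)
        rw [ENNReal.div_lt_iff (Or.inl hE) (Or.inl hE')]
        refine h1.trans_lt ?_
        rw [show g y * E = D * (C + 1) * g y * 2 by simp only [E]; ring]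
        have h3 : D * (C + 1) * g y ≠ 0 := by simp [hD, hgy]
        have h4 : D * (C + 1) * g y ≠ ⊤ := by finiteness
        rw [mul_two]
        exact ENNReal.lt_add_right h4 h3
      have h2 := hann g hg R hR (ENNReal.ofReal R ^ (α - A) / E).toNNReal
        (ENNReal.toNNReal_pos ht0 ht')
      rw [ENNReal.coe_toNNReal ht'] at h2
      have h3 : ann (0 : Euc n) R ∩ {x | ENNReal.ofReal R ^ (α - A) / E < g x} = ann 0 R :=
        inter_eq_left.2 hgt
      rw [h3] at h2
      have h4 : ENNReal.ofReal R ^ (n / q) * w ≤ volume (ann (0 : Euc n) R) ^ (1 / q) := by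
        have := le_volume_ann (n := n) 0 hR
        grw [← this]
        rw [ENNReal.mul_rpow_of_nonneg _ _ (by positivity), ← ENNReal.rpow_mul, mul_one_div]
      grw [← h4] at h2
      calc ENNReal.ofReal R ^ (a - (A - α))
          = E * (E⁻¹ * ENNReal.ofReal R ^ (α - A) * (ENNReal.ofReal R ^ (n / q) * w)) * w⁻¹ *
              ENNReal.ofReal R ^ (a - n / q) := by
            rw [show E * (E⁻¹ * ENNReal.ofReal R ^ (α - A) * (ENNReal.ofReal R ^ (n / q) * w)) *
              w⁻¹ * ENNReal.ofReal R ^ (a - n / q) = E * E⁻¹ * (w * w⁻¹) *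
              (ENNReal.ofReal R ^ (α - A) * ENNReal.ofReal R ^ (n / q) *
                ENNReal.ofReal R ^ (a - n / q)) by ring,
              ENNReal.mul_inv_cancel hE hE', ENNReal.mul_inv_cancel hw hw', one_mul, one_mul,
              ofReal_rpow_mul hR, ofReal_rpow_mul hR]
            congr 1; ring
        _ ≤ E * (C' * normWKS q l β g * ENNReal.ofReal R ^ (n / q - a)) * w⁻¹ *
              ENNReal.ofReal R ^ (a - n / q) := by
            rw [← ENNReal.div_eq_inv_mul]
            gcongr
        _ = E * (C' * normWKS q l β g) * w⁻¹ *
              (ENNReal.ofReal R ^ (n / q - a) * ENNReal.ofReal R ^ (a - n / q)) := by ring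
        _ = _ := by rw [ofReal_rpow_mul hR]; simp
    have := eq_zero_of_rpow_le (by finiteness) key
    linarith
  -- With x fixed, R^(α-A) stays bounded as R grows.
  · have h1 : 0 ≤ A - α := by
      refine nonneg_of_rpow_le (R₀ := ‖x‖) (ENNReal.mul_ne_top hD' hxM) fun R hxR hR => ?_
      rw [neg_sub]
      exact hlow x R (by simpa using hxR)
    linarith
  · by_contra! hA
    refine hxM (top_le_iff.1 ?_)
    have hR : 0 < ‖x‖ + 1 := by positivity
    have h1 : (∫⁻ y in ball (0 : Euc n) (‖x‖ + 1), radialPower A y) /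
        volume (ball (0 : Euc n) (‖x‖ + 1)) ^ (1 - α / n) ≤
          maximalPotential α (radialPower A) x :=
      le_iSup_of_le 0 (le_iSup_of_le (‖x‖ + 1) (le_iSup_of_le (by simp) le_rfl))
    refine le_trans ?_ h1
    have h2 : ∫⁻ y in ball (0 : Euc n) (‖x‖ + 1), radialPower A y = ⊤ := by
      rw [← top_le_iff, ← setLIntegral_ball_radialPower_eq_top hA]
      exact lintegral_mono_set (ball_subset_ball (by simp))
    rw [h2, ENNReal.top_div_of_ne_top]
    exact ENNReal.rpow_ne_top_of_ne_zero (measure_ball_pos _ _ hR).ne' measure_ball_lt_top.ne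

/-- The power function `x ↦ |x|^(-A)` as a scalar function. -/
noncomputable def scalarPower (𝕜 : Type*) [RCLike 𝕜] (A : ℝ) (x : Euc n) : 𝕜 :=
  ((‖x‖ ^ (-A) : ℝ) : 𝕜)

theorem enorm_scalarPower (A : ℝ) {x : Euc n} (hx : x ≠ 0) :
    ‖scalarPower 𝕜 A x‖ₑ = radialPower A x := by
  have h : 0 < ‖x‖ := norm_pos_iff.2 hx
  rw [scalarPower, radialPower, ← ofReal_norm, RCLike.norm_ofReal,
    abs_of_nonneg (Real.rpow_nonneg h.le _), ← ENNReal.ofReal_rpow_of_pos h, ofReal_norm]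

theorem enorm_scalarPower_ae_eq [NeZero n] (A : ℝ) :
    (fun x : Euc n => ‖scalarPower 𝕜 A x‖ₑ) =ᵐ[volume] radialPower A := by
  filter_upwards [ae_ne (0 : Euc n)] with x hx
  exact enorm_scalarPower A hx

theorem measurable_scalarPower (A : ℝ) : Measurable (scalarPower (n := n) 𝕜 A) :=
  RCLike.measurable_ofReal.comp (measurable_norm.pow_const _)

theorem mem_scalarPower [NeZero n] {p l β : ℝ} (hp : 0 < p) (hl : 0 < l) (h : 0 < β * p + n) :
    Mem (n := n) (normKS p l β) (scalarPower 𝕜 ((n - l) * (1 / p + β / n))) := by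
  refine ⟨(measurable_scalarPower _).aestronglyMeasurable, ?_⟩
  rw [normKS_congr_ae (h := radialPower ((n - l) * (1 / p + β / n)))
    (enorm_scalarPower_ae_eq _)]
  exact (normKS_radialPower_ne_top n hp hl h).lt_top

/-- The integrand is a nonnegative real, so nothing cancels. Integrability is essential, the Bochner
integral being 0 without it. -/
theorem enorm_fracIntegral_scalarPower [NeZero n] {α A : ℝ} {x : Euc n}
    (h : Integrable (fracIntegrand α (scalarPower 𝕜 A) x) volume) :
    ‖fracIntegral α (scalarPower 𝕜 A) x‖ₑ = potential α (radialPower A) x := by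
  have h1 : ∀ y, fracIntegrand α (scalarPower 𝕜 A) x y =
      (((‖x - y‖ ^ ((n : ℝ) - α))⁻¹ * ‖y‖ ^ (-A) : ℝ) : 𝕜) := by
    intro y
    rw [fracIntegrand, scalarPower, RCLike.real_smul_eq_coe_mul, RCLike.ofReal_mul]
  have h0 : ∀ y, 0 ≤ (‖x - y‖ ^ ((n : ℝ) - α))⁻¹ * ‖y‖ ^ (-A) := fun y => by positivity
  have hint : Integrable (fun y => (‖x - y‖ ^ ((n : ℝ) - α))⁻¹ * ‖y‖ ^ (-A)) volume := by
    refine h.norm.congr (.of_forall fun y => ?_)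
    simp only [h1, RCLike.norm_ofReal, abs_of_nonneg (h0 y)]
  have h2 : fracIntegral α (scalarPower 𝕜 A) x =
      ((∫ y, (‖x - y‖ ^ ((n : ℝ) - α))⁻¹ * ‖y‖ ^ (-A) : ℝ) : 𝕜) := by
    rw [← integral_ofReal]
    exact integral_congr_ae (.of_forall h1)
  rw [h2, ← ofReal_norm, RCLike.norm_ofReal, abs_of_nonneg (integral_nonneg h0),
    ofReal_integral_eq_lintegral_ofReal hint (.of_forall h0),
    ← potential_congr_ae α (enorm_scalarPower_ae_eq (𝕜 := 𝕜) A), ← lintegral_enorm_fracIntegrand]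
  refine lintegral_congr fun y => ?_
  rw [h1, ← ofReal_norm, RCLike.norm_ofReal, abs_of_nonneg (h0 y)]

section Necessity

variable {α p q l₁ l₂ β₁ β₂ : ℝ}

theorem exponents_of_fracMaximalBounded [NeZero n] (hαn : α < n) (hp : 0 < p) (hq : 0 < q)
    (hl₁ : 0 < l₁) (hl₂ : 0 < l₂) (hβ₁ : 0 < β₁ * p + n) (hβ₂ : 0 < β₂ * q + n)
    (h : FracMaximalBounded (n := n) (𝕜 := 𝕜) α (normKS p l₁ β₁) (normWKS q l₂ β₂)) :
    (n - l₂) * (1 / q + β₂ / n) = (n - l₁) * (1 / p + β₁ / n) - α ∧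
      α ≤ (n - l₁) * (1 / p + β₁ / n) ∧ (n - l₁) * (1 / p + β₁ / n) < n := by
  obtain ⟨C, h⟩ := h
  have h1 := (h _ (mem_scalarPower hp hl₁ hβ₁)).1.2
  rw [fracMaximal_eq, maximalPotential_congr_ae α (enorm_scalarPower_ae_eq _)] at h1
  exact exponents_of_normWKS_ne_top hαn hq hl₂ hβ₂ (measurable_maximalPotential α _) h1.ne
    ENNReal.one_ne_top fun x => by rw [one_mul]

theorem exponents_of_fracIntegralBounded [NeZero n] (hαn : α < n) (hp : 0 < p) (hq : 0 < q)
    (hl₁ : 0 < l₁) (hl₂ : 0 < l₂) (hβ₁ : 0 < β₁ * p + n) (hβ₂ : 0 < β₂ * q + n)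
    (h : FracIntegralBounded (n := n) (𝕜 := 𝕜) α (normKS p l₁ β₁) (normWKS q l₂ β₂)) :
    (n - l₂) * (1 / q + β₂ / n) = (n - l₁) * (1 / p + β₁ / n) - α ∧
      α < (n - l₁) * (1 / p + β₁ / n) ∧ (n - l₁) * (1 / p + β₁ / n) < n := by
  obtain ⟨C, h⟩ := h
  obtain ⟨hint, ⟨-, hN⟩, -⟩ := h _ (mem_scalarPower hp hl₁ hβ₁)
  set A := (n - l₁) * (1 / p + β₁ / n) with hA
  have hN' : normWKS q l₂ β₂ (potential (n := n) α (radialPower A)) ≠ ⊤ := by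
    refine ne_top_of_le_ne_top hN.ne (normWKS_mono hq.le ?_)
    filter_upwards [hint] with x hx
    rw [enorm_fracIntegral_scalarPower hx, enorm_eq_self]
  obtain ⟨D, hD, hle⟩ := exists_maximalPotential_le_potential n hαn
  obtain ⟨h1, h2, h3⟩ := exponents_of_normWKS_ne_top hαn hq hl₂ hβ₂
    (measurable_potential α (measurable_radialPower A)) hN' hD (hle _)
  -- Domination of the maximal function only gives α ≤ A; equality contradicts the almost everywhere
  -- convergence demanded by boundedness.
  refine ⟨h1, lt_of_le_of_ne h2 fun heq => ?_, h3⟩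
  obtain ⟨x, hx, hx0⟩ := (hint.and (ae_ne (0 : Euc n))).exists
  rw [integrable_fracIntegrand_iff (measurable_scalarPower _).aestronglyMeasurable,
    potential_congr_ae α (enorm_scalarPower_ae_eq _), ← heq,
    potential_radialPower_eq_top hαn hx0] at hx
  exact lt_irrefl _ hx

theorem FracIntegralBounded.weak (hq : 0 < q)
    (h : FracIntegralBounded (n := n) (𝕜 := 𝕜) α (normKS p l₁ β₁) (normKS q l₂ β₂)) :
    FracIntegralBounded (n := n) (𝕜 := 𝕜) α (normKS p l₁ β₁) (normWKS q l₂ β₂) := by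
  obtain ⟨C, h⟩ := h
  refine ⟨C, fun f hf => ?_⟩
  obtain ⟨h1, h2, h3⟩ := h f hf
  have hle := normWKS_le_normKS (l := l₂) (β := β₂) hq h2.1.enorm
  exact ⟨h1, ⟨h2.1, hle.trans_lt h2.2⟩, hle.trans h3⟩

theorem FracMaximalBounded.weak (hq : 0 < q)
    (h : FracMaximalBounded (n := n) (𝕜 := 𝕜) α (normKS p l₁ β₁) (normKS q l₂ β₂)) :
    FracMaximalBounded (n := n) (𝕜 := 𝕜) α (normKS p l₁ β₁) (normWKS q l₂ β₂) := by
  obtain ⟨C, h⟩ := h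
  refine ⟨C, fun f hf => ?_⟩
  obtain ⟨h2, h3⟩ := h f hf
  have hle := normWKS_le_normKS (l := l₂) (β := β₂) hq h2.1.enorm
  exact ⟨⟨h2.1, hle.trans_lt h2.2⟩, hle.trans h3⟩

end Necessity

end LocalMorrey

/-! ### Assembling the equivalences -/

theorem mainTheorem11 {𝕜 : Type*} [RCLike 𝕜] (n : ℕ) (α γ p q l₁ l₂ β₁ β₂ : ℝ)
    (hα : 0 < α) (hαn : α < n) (hγ : 0 ≤ γ) (hγα : γ ≤ α)
    (hp : 1 ≤ p) (hpγ : p * γ < n) (hpq : 1 / p - 1 / q = γ / n)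
    (hl₁ : 0 < l₁) (hl₂ : 0 < l₂) (hβ₁ : 0 < β₁ * p + n) (hβ₂ : 0 < β₂ * q + n) :
    -- the fractional integral, strong type
    (1 < p →
      (LocalMorrey.FracIntegralBounded (n := n) (𝕜 := 𝕜) α
          (LocalMorrey.normKS p l₁ β₁) (LocalMorrey.normKS q l₂ β₂) ↔
        ((n - l₂) * (1 / q + β₂ / n) - (n - l₁) * (1 / p + β₁ / n) + α = 0 ∧
          α < (n - l₁) * (1 / p + β₁ / n) ∧ (n - l₁) * (1 / p + β₁ / n) < n))) ∧
    -- the fractional integral, weak type for `p = 1`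
    (p = 1 →
      (LocalMorrey.FracIntegralBounded (n := n) (𝕜 := 𝕜) α
          (LocalMorrey.normKS p l₁ β₁) (LocalMorrey.normWKS q l₂ β₂) ↔
        ((n - l₂) * (1 / q + β₂ / n) - (n - l₁) * (1 / p + β₁ / n) + α = 0 ∧
          α < (n - l₁) * (1 / p + β₁ / n) ∧ (n - l₁) * (1 / p + β₁ / n) < n))) ∧
    -- the fractional maximal operator, strong type
    (1 < p →
      (LocalMorrey.FracMaximalBounded (n := n) (𝕜 := 𝕜) α
          (LocalMorrey.normKS p l₁ β₁) (LocalMorrey.normKS q l₂ β₂) ↔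
        ((n - l₂) * (1 / q + β₂ / n) - (n - l₁) * (1 / p + β₁ / n) + α = 0 ∧
          α ≤ (n - l₁) * (1 / p + β₁ / n) ∧ (n - l₁) * (1 / p + β₁ / n) < n))) ∧
    -- the fractional maximal operator, weak type for `p = 1`
    (p = 1 →
      (LocalMorrey.FracMaximalBounded (n := n) (𝕜 := 𝕜) α
          (LocalMorrey.normKS p l₁ β₁) (LocalMorrey.normWKS q l₂ β₂) ↔
        ((n - l₂) * (1 / q + β₂ / n) - (n - l₁) * (1 / p + β₁ / n) + α = 0 ∧
          α ≤ (n - l₁) * (1 / p + β₁ / n) ∧ (n - l₁) * (1 / p + β₁ / n) < n))) := by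
  have hn : (0 : ℝ) < n := hα.trans hαn
  have : NeZero n := ⟨by rintro rfl; simp at hn⟩
  have hp0 : 0 < p := by linarith
  -- The condition pγ < n makes 1/q = 1/p - γ/n positive, which rules out the default value 1/0 = 0.
  have hq' : 0 < 1 / q := by
    have : γ / n < 1 / p := by
      rw [div_lt_div_iff₀ hn hp0]
      linarith
    linarith
  have hq0 : 0 < q := one_div_pos.1 hq'
  have hq : 1 ≤ q := by
    have h1 : 0 ≤ γ / n := by positivity
    have h2 : 1 / p ≤ 1 := (div_le_one hp0).2 hp
    exact (div_le_one hq0).1 (by linarith)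
  refine ⟨fun h1p => ⟨fun h => ?_, fun ⟨h1, h2, h3⟩ => ?_⟩, fun h1p => ⟨fun h => ?_, ?_⟩,
    fun h1p => ⟨fun h => ?_, fun ⟨h1, h2, h3⟩ => ?_⟩, fun h1p => ⟨fun h => ?_, ?_⟩⟩
  · obtain ⟨h1, h2, h3⟩ := LocalMorrey.exponents_of_fracIntegralBounded hαn hp0 hq0 hl₁ hl₂ hβ₁ hβ₂
      (h.weak hq0)
    exact ⟨by linarith, h2, h3⟩
  · exact LocalMorrey.fracIntegralBounded_strong hα hγ hγα h1p hpγ hpq hq hl₁ hl₂ hβ₁ hβ₂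
      (by linarith) h2 h3
  · obtain ⟨h1, h2, h3⟩ := LocalMorrey.exponents_of_fracIntegralBounded hαn hp0 hq0 hl₁ hl₂ hβ₁ hβ₂ h
    exact ⟨by linarith, h2, h3⟩
  · subst h1p
    rintro ⟨h1, h2, h3⟩
    exact LocalMorrey.fracIntegralBounded_weak hα hγ hγα hpγ hpq hq hl₁ hl₂ hβ₁ hβ₂
      (by linarith) h2 h3
  · obtain ⟨h1, h2, h3⟩ := LocalMorrey.exponents_of_fracMaximalBounded hαn hp0 hq0 hl₁ hl₂ hβ₁ hβ₂
      (h.weak hq0)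
    exact ⟨by linarith, h2, h3⟩
  · exact LocalMorrey.fracMaximalBounded_strong hα hαn hγ hγα h1p hpγ hpq hq hl₁ hl₂ hβ₁ hβ₂
      (by linarith) h2 h3
  · obtain ⟨h1, h2, h3⟩ := LocalMorrey.exponents_of_fracMaximalBounded hαn hp0 hq0 hl₁ hl₂ hβ₁ hβ₂ h
    exact ⟨by linarith, h2, h3⟩
  · subst h1p
    rintro ⟨h1, h2, h3⟩
    exact LocalMorrey.fracMaximalBounded_weak hα hαn hγ hγα hpγ hpq hq hl₁ hl₂ hβ₁ hβ₂
      (by linarith) h2 h3
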